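/- **Setting.** Let $n\ge 1$ and $p_0\ge p_1\ge\dots\ge p_n\ge 1$ be integers, $N=p_0+\dots+p_n$, and write $x=(x^{(p_0)},\dots,x^{(p_n)})\in\mathbb R^N=\mathbb R^{p_0}\times\dots\times\mathbb R^{p_n}$. Let $B\in\mathbb R^{N\times N}$ be a matrix whose blocks (with respect to this splitting, indexed by $0,\dots,n$) all vanish except the blocks $\mathbb B_j\in\mathbb R^{p_{j-1}\times p_j}$ in position $(j-1,j)$, $j=1,\dots,n$, and let $\operatorname{rank}\mathbb B_j=p_j$. Put $$Q=\sum_{i=0}^n(2i+1)p_i,\quad E(s)=\exp(-sB^T),\quad (x,t)\circ(\xi,\tau)=(\xi+E(\tau)x,\;t+\tau),\quad |x|_B=\sum_{i=0}^n|x^{(p_i)}|^{\frac1{2i+1}},$$ and, for $z_0\in\mathbb R^{N+1}$, $r>0$, $t_1<t_2$, $$\mathcal Q_r^{t_1,t_2}(z_0)=\{z_0\circ(\xi,\tau):\ |\xi|_B<r,\ t_1<\tau<t_2\}.$$ For an open set $\Omega\subseteq\mathbb R^{N+1}$ and constants $\lambda,\Lambda>0$ consider $$\mathcal L_A=\operatorname{tr}(A(z)D_x^2)+\langle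 x,B\nabla_x\rangle-\partial_t,\qquad z=(x,t)\in\Omega,$$ where $A(z)$ is a symmetric $N\times N$ matrix which vanishes outside its upper left $p_0\times p_0$ block $\mathbb A(z)$, and $\lambda\mathbb I_{p_0}\le\mathbb A(z)\le\Lambda\mathbb I_{p_0}$ for all $z\in\Omega$ (no regularity of $A$ is assumed). **Theorem 1.1.** Assume the Cordes–Landis condition $\Lambda/\lambda<1+2/Q$, and let $\sigma_0=\min_{|x|=1}|x|_B>0$ and $\bar\sigma=\max_{|x|=1}|x|_B$. There are constants $b_B,K,C>0$, depending only on $n,p_0,\dots,p_n,B,\lambda,\Lambda$, with $K>\sigma_0$, $b_B\le(\sigma_0/\bar\sigma)^2$ and $\|E(s)\|\le2$ (operator norm) for $|s|\le b_B$, such that the following holds for all such $\Omega$ and $A$. If $z_0\in\mathbb R^{N+1}$, $r>0$, the closure of $\mathcal Q_{Kr}^{-b_Br^2,0}(z_0)$ is a compact subset of $\Omega$, and $u\in C^2(\Omega)$ satisfies $$u\ge0\quad\text{and}\quad\mathcal L_Au=0\quad\text{in }\mathcal Q_{Kr}^{-b_Br^2,0}(z_0),$$ then $$\sup_{\mathcal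 Q_r^-}u\le C\inf_{\mathcal Q_r^+}u,\qquad \mathcal Q_r^-=\mathcal Q_{\frac{\sigma_0}2r}^{-\frac{3b_B}4r^2,-\frac{b_B}2r^2}(z_0),\quad \mathcal Q_r^+=\mathcal Q_{\frac{\sigma_0}2r}^{-\frac{b_B}4r^2,0}(z_0).$$ -/

import Mathlib

noncomputable section

namespace Kolmogorov

/-- Coordinates of `ℝ^N = ℝ^{p₀} × ⋯ × ℝ^{pₙ}`: the pair `⟨i, a⟩` is the `a`-th coordinate of the
`i`-th block, so that `N = p₀ + ⋯ + pₙ`. -/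
abbrev Coord {n : ℕ} (p : Fin (n + 1) → ℕ) : Type := Σ i : Fin (n + 1), Fin (p i)

/-- `ℝ^N` with its Euclidean norm. -/
abbrev Space {n : ℕ} (p : Fin (n + 1) → ℕ) : Type := EuclideanSpace ℝ (Coord p)

/-- `ℝ^{N+1}`, with points `z = (x, t)`. -/
abbrev SpaceTime {n : ℕ} (p : Fin (n + 1) → ℕ) : Type := Space p × ℝ

variable {n : ℕ} {p : Fin (n + 1) → ℕ}

/-- The `(i, k)` block, of size `pᵢ × pₖ`, of an `N × N` matrix. -/
def block (M : Matrix (Coord p) (Coord p) ℝ) (i k : Fin (n + 1)) :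
    Matrix (Fin (p i)) (Fin (p k)) ℝ :=
  Matrix.of fun a b => M ⟨i, a⟩ ⟨k, b⟩

/-- The homogeneous dimension `Q = p₀ + 3 p₁ + ⋯ + (2n+1) pₙ` of the spatial part. -/
def homDim (p : Fin (n + 1) → ℕ) : ℕ := ∑ i : Fin (n + 1), (2 * (i : ℕ) + 1) * p i

/-- Block structure of the drift matrix: the only nonzero blocks are the blocks `𝔹ⱼ` in position
`(j - 1, j)`, `j = 1, …, n`, and `𝔹ⱼ` (of size `p_{j-1} × p_j`) has rank `p_j`. -/
structure IsDriftMatrix (B : Matrix (Coord p) (Coord p) ℝ) : Prop where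
  block_eq_zero : ∀ i k : Fin (n + 1), (k : ℕ) ≠ (i : ℕ) + 1 → block B i k = 0
  rank_block : ∀ j : Fin n, (block B j.castSucc j.succ).rank = p j.succ

/-- The coefficient matrix `A` is, at every point of `Ω`, symmetric, zero outside its upper left
`p₀ × p₀` block `𝔸(z)`, and `lam 𝕀 ≤ 𝔸(z) ≤ Lam 𝕀`. -/
structure IsCoefficient (Ω : Set (SpaceTime p)) (lam Lam : ℝ)
    (A : SpaceTime p → Matrix (Coord p) (Coord p) ℝ) : Prop where
  isSymm : ∀ z ∈ Ω, (A z).IsSymm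
  block_eq_zero : ∀ z ∈ Ω, ∀ i k : Fin (n + 1), ¬(i = 0 ∧ k = 0) → block (A z) i k = 0
  lower : ∀ z ∈ Ω, ∀ v : Fin (p 0) → ℝ,
    lam * (v ⬝ᵥ v) ≤ v ⬝ᵥ ((block (A z) 0 0).mulVec v)
  upper : ∀ z ∈ Ω, ∀ v : Fin (p 0) → ℝ,
    v ⬝ᵥ ((block (A z) 0 0).mulVec v) ≤ Lam * (v ⬝ᵥ v)

/-- The partial derivative `∂_{x_i}`. -/
def dx (i : Coord p) (u : SpaceTime p → ℝ) (z : SpaceTime p) : ℝ :=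
  fderiv ℝ u z (EuclideanSpace.single i 1, 0)

/-- The partial derivative `∂_t`. -/
def dt (u : SpaceTime p → ℝ) (z : SpaceTime p) : ℝ := fderiv ℝ u z (0, 1)

/-- The spatial gradient `∇u`. -/
def grad (u : SpaceTime p → ℝ) (z : SpaceTime p) : Coord p → ℝ := fun i => dx i u z

/-- The spatial Hessian `D²u`. -/
def hess (u : SpaceTime p → ℝ) (z : SpaceTime p) : Matrix (Coord p) (Coord p) ℝ :=
  Matrix.of fun i j => dx i (dx j u) z

/-- The operator `L_A u = tr(A D²u) + ⟨x, B∇u⟩ - ∂_t u`. -/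
def operatorL (B : Matrix (Coord p) (Coord p) ℝ) (A : SpaceTime p → Matrix (Coord p) (Coord p) ℝ)
    (u : SpaceTime p → ℝ) (z : SpaceTime p) : ℝ :=
  (A z * hess u z).trace + (z.1 : Coord p → ℝ) ⬝ᵥ (B.mulVec (grad u z)) - dt u z

/-- `E(s) = exp(-s Bᵀ)`, as a linear operator of the Euclidean space `ℝ^N`. -/
def E (B : Matrix (Coord p) (Coord p) ℝ) (s : ℝ) : Space p →L[ℝ] Space p :=
  Matrix.toEuclideanCLM (n := Coord p) (𝕜 := ℝ) (NormedSpace.exp (-s • B.transpose))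

/-- The group law `(x, t) ∘ (ξ, τ) = (ξ + E(τ) x, t + τ)`. -/
def groupMul (B : Matrix (Coord p) (Coord p) ℝ) (z ζ : SpaceTime p) : SpaceTime p :=
  (ζ.1 + E B ζ.2 z.1, z.2 + ζ.2)

/-- The block component `x^{(p_i)}` of `x`. -/
def component (x : Space p) (i : Fin (n + 1)) : EuclideanSpace ℝ (Fin (p i)) :=
  WithLp.toLp 2 fun a => x ⟨i, a⟩

/-- The homogeneous norm `|x|_B = ∑ᵢ |x^{(pᵢ)}|^{1/(2i+1)}`. -/
def homNorm (x : Space p) : ℝ :=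
  ∑ i : Fin (n + 1), ‖component x i‖ ^ (1 / (2 * (i : ℝ) + 1))

/-- The homogeneous ball `B_r(0)`. -/
def homBall (p : Fin (n + 1) → ℕ) (r : ℝ) : Set (Space p) := {x | homNorm x < r}

/-- The cylinder `Q_r^{t₁,t₂}(z₀) = z₀ ∘ (B_r(0) × (t₁, t₂))`. -/
def cylinder (B : Matrix (Coord p) (Coord p) ℝ) (r t₁ t₂ : ℝ) (z₀ : SpaceTime p) :
    Set (SpaceTime p) :=
  groupMul B z₀ '' (homBall p r ×ˢ Set.Ioo t₁ t₂)

/-- `S ⋐ Ω`. -/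
def CompactlyContained (S Ω : Set (SpaceTime p)) : Prop :=
  IsCompact (closure S) ∧ closure S ⊆ Ω

end Kolmogorov

end

/-! Write I₀ for the projection onto block 0, δ_r for the dilations, and C(t) = ∫₀ᵗ E(s) I₀ E(s)ᵀ ds
= δ_{√t} C(1) δ_{√t}. When A = λI₀ the operator has, up to a factor, the fundamental solution
t^{-Q/2} exp(-⟨C(t)⁻¹x, x⟩/(4λ)). Replacing Q/2 by s = ΛQ/(2λ) turns it into a subsolution for all
admissible A at once, with no regularity of A (`IsDriftMatrix.operatorL_kernelLog_nonneg`): the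
gradient term is bounded below through λ, the trace term through Λ, and the identity tr(C(1)⁻¹I₀) =
Q fixes s. The Cordes–Landis condition says exactly s < Q/2 + 1, which is what makes the kernel
integrable near its pole, so that its potentials are bounded (`IsDriftMatrix.exists_potential_le`).

Let u ≥ 0 be a supersolution with u ≥ ℓ on a compact subset H of a lower cylinder. The potential of
H is bounded, is at least a multiple of |H| in a later cylinder, and is comparatively small on a
distant lateral boundary. The minimum principle then gives u ≥ cℓ|H| in the later cylinder
(`IsDriftMatrix.exists_weakEstimate`). The potential is replaced by finite sums of kernels with
poles in H, so its own regularity is never at issue.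

This estimate is used twice. Applied to u, it shows that {u ≥ M/2} is small when M is large compared
with u(w). Applied to (1+η)M - u in a small cylinder below a point where u > M, it shows that u
exceeds (1+η)M somewhere in that cylinder (`IsDriftMatrix.exists_growth`). If u(z) > C u(w),
iteration gives points where u grows geometrically while the radii shrink geometrically; the points
stay in a compact set, on which u is bounded, a contradiction (`IsDriftMatrix.exists_harnack`). Left
translations and dilations preserve the class of operators and carry the result to every z₀ and r.
-/

noncomputable section

namespace Kolmogorov

open Matrix Finset Filter Topology MeasureTheory

variable {n : ℕ} {p : Fin (n + 1) → ℕ} {B : Matrix (Coord p) (Coord p) ℝ}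
  {A : SpaceTime p → Matrix (Coord p) (Coord p) ℝ} {u v : SpaceTime p → ℝ} {z : SpaceTime p}

/-! ### Algebra of the drift matrix: observability, covariance, Lyapunov equation -/

/-- The Gram matrix `(1 / (i + k + 1))` of the monomials in `L²(0, 1)` is positive definite. -/
theorem hilbert_form_nonneg (m : ℕ) (a : ℕ → ℝ) :
    0 ≤ ∑ i ∈ range m, ∑ k ∈ range m, a i * a k / (i + k + 1 : ℝ) ∧
      (∑ i ∈ range m, ∑ k ∈ range m, a i * a k / (i + k + 1 : ℝ) = 0 → ∀ i < m, a i = 0) := by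
  set P : Polynomial ℝ := ∑ i ∈ range m, Polynomial.monomial i (a i) with hP
  have hev : ∀ s : ℝ, P.eval s = ∑ i ∈ range m, a i * s ^ i := fun s => by
    simp [hP, Polynomial.eval_finsetSum]
  -- The form is ∫₀¹ P², because 1/(i+k+1) is the integral of s^(i+k); a polynomial vanishing on (0,
  -- 1) is zero.
  have hint : ∑ i ∈ range m, ∑ k ∈ range m, a i * a k / (i + k + 1 : ℝ) =
      ∫ s in (0 : ℝ)..1, (P.eval s) ^ 2 := by
    have h1 : ∀ s : ℝ, (P.eval s) ^ 2 =
        ∑ i ∈ range m, ∑ k ∈ range m, a i * a k * s ^ (i + k) := fun s => by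
      rw [hev, sq, sum_mul_sum]
      exact sum_congr rfl fun i _ => sum_congr rfl fun k _ => by ring
    simp_rw [h1]
    rw [intervalIntegral.integral_finsetSum]
    · refine sum_congr rfl fun i _ => ?_
      rw [intervalIntegral.integral_finsetSum]
      · refine sum_congr rfl fun k _ => ?_
        rw [intervalIntegral.integral_const_mul, integral_pow]
        push_cast
        simp [div_eq_mul_inv]
      · intro k _
        exact (by fun_prop : Continuous fun s : ℝ => a i * a k * s ^ (i + k)).intervalIntegrable _ _
    · intro i _
      exact (by fun_prop :
        Continuous fun s : ℝ => ∑ k ∈ range m, a i * a k * s ^ (i + k)).intervalIntegrable _ _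
  have hcont : Continuous fun s : ℝ => (P.eval s) ^ 2 := P.continuous.pow 2
  refine ⟨?_, fun h0 => ?_⟩
  · rw [hint]
    exact intervalIntegral.integral_nonneg zero_le_one fun s _ => sq_nonneg _
  · rw [hint] at h0
    have hz : ∀ s ∈ Set.Ioo (0 : ℝ) 1, P.eval s = 0 := by
      intro s hs
      by_contra hne
      have := intervalIntegral.integral_pos zero_lt_one hcont.continuousOn
        (fun s _ => sq_nonneg (P.eval s)) ⟨s, ⟨hs.1.le, hs.2.le⟩, by positivity⟩
      exact this.ne' h0
    have hP0 : P = 0 := by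
      refine Polynomial.eq_zero_of_infinite_isRoot P ((Set.Ioo_infinite zero_lt_one).mono ?_)
      exact fun s hs => hz s hs
    intro i hi
    have := congrArg (fun R : Polynomial ℝ => R.coeff i) hP0
    simpa [hP, Polynomial.finsetSum_coeff, Polynomial.coeff_monomial, hi] using this

theorem IsDriftMatrix.index_eq (hB : IsDriftMatrix B) {c d : Coord p} (h : B c d ≠ 0) :
    (d.1 : ℕ) = c.1 + 1 := by
  by_contra hne
  have := congrFun (congrFun (hB.block_eq_zero c.1 d.1 hne) c.2) d.2
  exact h this

theorem IsDriftMatrix.pow_index_eq (hB : IsDriftMatrix B) (k : ℕ) {c d : Coord p}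
    (h : (B ^ k) c d ≠ 0) : (d.1 : ℕ) = c.1 + k := by
  induction k generalizing d with
  | zero =>
    have : c = d := by
      by_contra hne
      simp [hne] at h
    simp [this]
  | succ k ih =>
    rw [pow_succ, Matrix.mul_apply] at h
    obtain ⟨e, -, he⟩ := exists_ne_zero_of_sum_ne_zero h
    have h1 := ih (left_ne_zero_of_mul he)
    have h2 := hB.index_eq (right_ne_zero_of_mul he)
    omega

theorem IsDriftMatrix.pow_eq_zero (hB : IsDriftMatrix B) : B ^ (n + 1) = 0 := by
  ext c d
  by_contra h
  have := hB.pow_index_eq (n + 1) h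
  have := d.1.2
  omega

theorem IsDriftMatrix.trace_eq_zero (hB : IsDriftMatrix B) : B.trace = 0 := by
  refine sum_eq_zero fun c _ => ?_
  by_contra h
  have := hB.index_eq h
  omega

/-- The projection onto the block `0`. -/
def projZero (p : Fin (n + 1) → ℕ) : Matrix (Coord p) (Coord p) ℝ :=
  diagonal fun c => if c.1 = 0 then 1 else 0

/-- The diagonal matrix with entries `i + 1/2` on the block `i`. -/
def degreeMatrix (p : Fin (n + 1) → ℕ) : Matrix (Coord p) (Coord p) ℝ :=
  diagonal fun c => (c.1 : ℝ) + 1 / 2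

/-- If the block-`0` components of all `Bⁱ x` vanish, then `x = 0`. -/
theorem IsDriftMatrix.observable (hB : IsDriftMatrix B) (x : Coord p → ℝ)
    (h : ∀ i, (projZero p).mulVec ((B ^ i).mulVec x) = 0) : x = 0 := by
  suffices H : ∀ m : ℕ, ∀ x : Coord p → ℝ, (∀ i, (projZero p).mulVec ((B ^ i).mulVec x) = 0) →
      ∀ c : Coord p, (c.1 : ℕ) ≤ m → x c = 0 from
    funext fun c => H c.1 x h c le_rfl
  intro m
  induction m with
  | zero =>
    intro x hx c hc
    have h0 := congrFun (hx 0) c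
    have hc0 : c.1 = 0 := Fin.ext (by simpa using hc)
    simpa [projZero, mulVec_diagonal, hc0] using h0
  | succ m ih =>
    intro x hx c hc
    rcases Nat.lt_or_ge c.1 (m + 1) with hlt | hge
    · exact ih x hx c (by omega)
    have hcm : (c.1 : ℕ) = m + 1 := le_antisymm hc hge
    have hm : m < n := by have := c.1.2; omega
    set j : Fin n := ⟨m, hm⟩
    -- The hypothesis passes from `x` to `Bx`, so the induction applies to `Bx`: its blocks up to
    -- `m` vanish, and block `m` of `Bx` is 𝔹 applied to block `m + 1` of `x`.
    have hBx : ∀ d : Coord p, (d.1 : ℕ) ≤ m → (B.mulVec x) d = 0 := ih (B.mulVec x) fun i => by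
      rw [mulVec_mulVec x, ← pow_succ]
      exact hx (i + 1)
    have hker : (block B j.castSucc j.succ).mulVec (fun b => x ⟨j.succ, b⟩) = 0 := by
      funext a
      have h1 := hBx ⟨j.castSucc, a⟩ (by simp [j])
      rw [mulVec, dotProduct, Fintype.sum_sigma, Finset.sum_eq_single j.succ] at h1
      · simpa [mulVec, dotProduct, block] using h1
      · intro k _ hk
        refine sum_eq_zero fun b _ => ?_
        have : B ⟨j.castSucc, a⟩ ⟨k, b⟩ = 0 := by
          by_contra hne
          have := hB.index_eq hne
          exact hk (Fin.ext (by simpa using this))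
        simp [this]
      · simp
    have hinj : Function.Injective (block B j.castSucc j.succ).mulVec := by
      rw [mulVec_injective_iff, linearIndependent_iff_card_eq_finrank_span, Fintype.card_fin,
        Set.finrank, ← rank_eq_finrank_span_cols, hB.rank_block j]
    have hz := hinj (hker.trans (mulVec_zero _).symm)
    obtain ⟨ci, ca⟩ := c
    have : ci = j.succ := Fin.ext (by simpa [j] using hcm)
    subst this
    exact congrFun hz ca

/-- The terms `(-B)ⁱ / i!` of the exponential series of `-B`. -/
def expTerm (B : Matrix (Coord p) (Coord p) ℝ) (i : ℕ) : Matrix (Coord p) (Coord p) ℝ :=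
  ((-1) ^ i / (i.factorial : ℝ)) • B ^ i

theorem expTerm_mul (i : ℕ) : expTerm B i * B = -((i : ℝ) + 1) • expTerm B (i + 1) := by
  rw [expTerm, expTerm, smul_mul_assoc, ← pow_succ, smul_smul, Nat.factorial_succ]
  congr 1
  push_cast
  have : (i.factorial : ℝ) ≠ 0 := by positivity
  have : (i : ℝ) + 1 ≠ 0 := by positivity
  field_simp
  ring

/-- The covariance matrix `∫₀¹ E(s) I₀ E(s)ᵀ ds`, where `I₀` is the projection onto block `0`. -/
def covariance (B : Matrix (Coord p) (Coord p) ℝ) : Matrix (Coord p) (Coord p) ℝ :=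
  ∑ i ∈ range (n + 1), ∑ k ∈ range (n + 1),
    (1 / (i + k + 1 : ℝ)) • ((expTerm B i)ᵀ * projZero p * expTerm B k)

theorem projZero_transpose : (projZero p)ᵀ = projZero p := diagonal_transpose _

theorem projZero_mul_self : projZero p * projZero p = projZero p := by
  simp [projZero, diagonal_mul_diagonal]

theorem covariance_transpose : (covariance B)ᵀ = covariance B := by
  simp only [covariance, transpose_sum, transpose_smul, transpose_mul, transpose_transpose,
    projZero_transpose]
  rw [sum_comm]
  exact sum_congr rfl fun i _ => sum_congr rfl fun k _ => by
    rw [Matrix.mul_assoc, add_comm (k : ℝ)]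

theorem covariance_form (x : Coord p → ℝ) :
    x ⬝ᵥ (covariance B).mulVec x = ∑ c, ∑ i ∈ range (n + 1), ∑ k ∈ range (n + 1),
      (projZero p).mulVec ((expTerm B i).mulVec x) c *
        (projZero p).mulVec ((expTerm B k).mulVec x) c / (i + k + 1 : ℝ) := by
  rw [sum_comm]
  simp only [covariance, sum_mulVec, dotProduct_sum]
  refine sum_congr rfl fun i _ => ?_
  rw [sum_comm]
  refine sum_congr rfl fun k _ => ?_
  rw [smul_mulVec, dotProduct_smul, ← sum_div, smul_eq_mul, one_div, inv_mul_eq_div]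
  congr 1
  change _ = (projZero p).mulVec ((expTerm B i).mulVec x) ⬝ᵥ
    (projZero p).mulVec ((expTerm B k).mulVec x)
  conv_rhs => rw [dotProduct_mulVec, ← mulVec_transpose, projZero_transpose, mulVec_mulVec,
    projZero_mul_self]
  rw [← mulVec_mulVec, ← mulVec_mulVec, dotProduct_mulVec, vecMul_transpose, dotProduct_mulVec,
    ← mulVec_transpose, projZero_transpose]

/-- The form is ∫₀¹ |I₀ exp(-sB)x|² ds. If it vanishes, so do all coefficients of the polynomial I₀
exp(-sB)x in s, and observability gives x = 0. -/
theorem IsDriftMatrix.covariance_posDef (hB : IsDriftMatrix B) : (covariance B).PosDef := by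
  refine .of_dotProduct_mulVec_pos ?_ fun x hx => ?_
  · rw [IsHermitian, conjTranspose_eq_transpose_of_trivial, covariance_transpose]
  rw [star_trivial, covariance_form]
  have hnn := fun c => (hilbert_form_nonneg (n + 1)
    fun i => (projZero p).mulVec ((expTerm B i).mulVec x) c)
  refine (sum_nonneg fun c _ => (hnn c).1).lt_of_ne fun h0 => hx ?_
  have h1 := (sum_eq_zero_iff_of_nonneg fun c _ => (hnn c).1).1 h0.symm
  refine hB.observable x fun i => ?_
  rcases Nat.lt_or_ge i (n + 1) with hi | hi
  · funext c
    have h2 := (hnn c).2 (h1 c (mem_univ c)) i hi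
    simp only [expTerm, smul_mulVec, mulVec_smul, Pi.smul_apply, smul_eq_mul] at h2
    refine (mul_eq_zero.1 h2).resolve_left ?_
    have : (i.factorial : ℝ) ≠ 0 := by positivity
    exact div_ne_zero (pow_ne_zero _ (by norm_num)) this
  · have : B ^ i = 0 := by
      rw [← Nat.add_sub_cancel' hi, pow_add, hB.pow_eq_zero, Matrix.zero_mul]
    simp [this]

/-- `B ^ k` raises the block index by k, so only columns of block k survive in I₀Bᵏ, and there the
degree matrix is the scalar k + 1/2. -/
theorem IsDriftMatrix.expTerm_mul_degree (hB : IsDriftMatrix B) (k : ℕ) :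
    projZero p * expTerm B k * degreeMatrix p =
      ((k : ℝ) + 1 / 2) • (projZero p * expTerm B k) := by
  ext c d
  rw [degreeMatrix, mul_diagonal, projZero, Matrix.smul_apply, diagonal_mul, smul_eq_mul]
  by_cases hc : c.1 = 0
  · by_cases h : (B ^ k) c d = 0
    · simp [expTerm, h]
    · have := hB.pow_index_eq k h
      rw [hc] at this
      simp only [Fin.val_zero, zero_add] at this
      rw [this]; ring
  · simp [hc]

/-- Multiplication by `B` shifts the exponential series by one index; the last term dies by
nilpotency. The truncated `k - 1` at k = 0 is harmless, as its factor k vanishes. -/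
theorem IsDriftMatrix.sum_mul_drift (hB : IsDriftMatrix B) (f : ℕ → ℝ)
    (X : Matrix (Coord p) (Coord p) ℝ) :
    (∑ k ∈ range (n + 1), f k • (X * expTerm B k)) * B =
      ∑ k ∈ range (n + 1), (-(k : ℝ) * f (k - 1)) • (X * expTerm B k) := by
  have h1 : ∀ k, (f k • (X * expTerm B k)) * B =
      (-((k + 1 : ℕ) : ℝ) * f (k + 1 - 1)) • (X * expTerm B (k + 1)) := fun k => by
    rw [smul_mul_assoc, Matrix.mul_assoc, expTerm_mul, Matrix.mul_smul, smul_smul]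
    congr 1
    push_cast
    ring
  simp_rw [Matrix.sum_mul, h1]
  have h2 := sum_range_succ' (fun k => (-(k : ℝ) * f (k - 1)) • (X * expTerm B k)) (n + 1)
  rw [sum_range_succ] at h2
  have h3 : expTerm B (n + 1) = 0 := by rw [expTerm, hB.pow_eq_zero, smul_zero]
  simpa [h3] using h2.symm

theorem IsDriftMatrix.covariance_mul (hB : IsDriftMatrix B) :
    covariance B * (B + degreeMatrix p) = ∑ i ∈ range (n + 1), ∑ k ∈ range (n + 1),
      (((k : ℝ) + 1 / 2) / (i + k + 1) - k / (i + k)) •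
        ((expTerm B i)ᵀ * projZero p * expTerm B k) := by
  rw [covariance, Matrix.sum_mul]
  refine sum_congr rfl fun i _ => ?_
  rw [Matrix.mul_add, hB.sum_mul_drift fun k => 1 / (i + k + 1 : ℝ), Matrix.sum_mul,
    ← sum_add_distrib]
  refine sum_congr rfl fun k _ => ?_
  rw [smul_mul_assoc, Matrix.mul_assoc, Matrix.mul_assoc,
    hB.expTerm_mul_degree, Matrix.mul_smul, smul_smul, ← add_smul]
  congr 1
  rcases k with _ | k
  · simp; ring
  · have : (i : ℝ) + (k + 1) ≠ 0 := by positivity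
    push_cast
    rw [show (i : ℝ) + k + 1 = i + (k + 1) by ring]
    ring

/-- The Lyapunov equation of the covariance matrix. -/
theorem IsDriftMatrix.lyapunov (hB : IsDriftMatrix B) :
    covariance B * (B + degreeMatrix p) + (covariance B * (B + degreeMatrix p))ᵀ = projZero p := by
  rw [hB.covariance_mul]
  simp only [transpose_sum, transpose_smul, transpose_mul, transpose_transpose,
    projZero_transpose]
  nth_rewrite 2 [sum_comm]
  rw [← sum_add_distrib]
  simp_rw [← sum_add_distrib]
  have h1 : ∀ i k : ℕ, (((k : ℝ) + 1 / 2) / (i + k + 1) - k / (i + k)) •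
        ((expTerm B i)ᵀ * projZero p * expTerm B k) +
      (((i : ℝ) + 1 / 2) / (k + i + 1) - i / (k + i)) •
        ((expTerm B i)ᵀ * (projZero p * expTerm B k)) =
      if i = 0 ∧ k = 0 then projZero p else 0 := by
    intro i k
    rw [← Matrix.mul_assoc, ← add_smul]
    -- After symmetrization the coefficient is 1 - (i+k)/(i+k). It vanishes except at i = k = 0,
    -- where 0/0 = 0 leaves 1 and the term I₀. Analytically, this compares C'(1) from the scaling of
    -- C(t) with C'(1) from its differential equation.
    have e : ((k : ℝ) + 1 / 2) / (i + k + 1) - k / (i + k) +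
        (((i : ℝ) + 1 / 2) / (k + i + 1) - i / (k + i)) = 1 - (i + k) / (i + k) := by
      rw [add_comm (k : ℝ) i]
      have : (i : ℝ) + k + 1 ≠ 0 := by positivity
      field_simp
      ring
    rw [e]
    split_ifs with h
    · simp [h.1, h.2, expTerm]
    · have : (i : ℝ) + k ≠ 0 := by
        intro h0
        have : i + k = 0 := by exact_mod_cast h0
        omega
      rw [div_self this, sub_self, zero_smul]
  simp_rw [h1]
  rw [sum_eq_single 0, sum_eq_single 0]
  · simp
  · intro k _ hk; simp [hk]
  · simp
  · intro i _ hi; simp [hi]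
  · simp

/-- Multiplying the Lyapunov equation by the inverse covariance and taking traces leaves twice the
trace of `B + degreeMatrix p`. The drift has trace zero, and twice the sum of the weights i + 1/2 is
Q. -/
theorem IsDriftMatrix.trace_inv_covariance (hB : IsDriftMatrix B) :
    ((covariance B)⁻¹ * projZero p).trace = (homDim p : ℝ) := by
  have hu : IsUnit (covariance B).det := (Matrix.isUnit_iff_isUnit_det _).1 hB.covariance_posDef.isUnit
  rw [← hB.lyapunov, Matrix.mul_add, trace_add, transpose_mul, covariance_transpose,
    ← Matrix.mul_assoc, nonsing_inv_mul _ hu, Matrix.one_mul, trace_mul_comm, Matrix.mul_assoc,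
    mul_nonsing_inv _ hu, Matrix.mul_one, trace_transpose, trace_add, hB.trace_eq_zero, homDim,
    degreeMatrix, trace_diagonal, Fintype.sum_sigma]
  push_cast
  simp only [sum_const, card_univ, Fintype.card_fin, nsmul_eq_mul, zero_add]
  rw [← sum_add_distrib]
  exact sum_congr rfl fun i _ => by ring

/-! ### Dilations, the exponential E(s), and charts of the group -/

/-- The anisotropic dilation `x^{(i)} ↦ r^{2i+1} x^{(i)}`. -/
def dil (r : ℝ) : Space p →L[ℝ] Space p :=
  Matrix.toEuclideanCLM (n := Coord p) (𝕜 := ℝ) (diagonal fun c => r ^ (2 * (c.1 : ℕ) + 1))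

/-- The transposed drift matrix as an operator of the Euclidean space `ℝ^N`. -/
def driftCLM (B : Matrix (Coord p) (Coord p) ℝ) : Space p →L[ℝ] Space p :=
  Matrix.toEuclideanCLM (n := Coord p) (𝕜 := ℝ) B.transpose

@[simp] theorem dil_apply (r : ℝ) (x : Space p) (c : Coord p) :
    dil r x c = r ^ (2 * (c.1 : ℕ) + 1) * x c := by
  change (diagonal (fun c : Coord p => r ^ (2 * (c.1 : ℕ) + 1)) *ᵥ (x : Coord p → ℝ)) c = _
  rw [mulVec_diagonal]

theorem driftCLM_apply (x : Space p) (c : Coord p) :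
    driftCLM B x c = ∑ d, B d c * x d := rfl

section Exponential

variable {V : Type*} [NormedAddCommGroup V] [NormedSpace ℝ V]

theorem exp_zero_smul (T : V →L[ℝ] V) : NormedSpace.exp ((0 : ℝ) • T) = 1 := by
  rw [zero_smul, NormedSpace.exp_zero]

variable [CompleteSpace V]

theorem exp_add_smul (T : V →L[ℝ] V) (s t : ℝ) :
    NormedSpace.exp ((s + t) • T) = NormedSpace.exp (s • T) * NormedSpace.exp (t • T) := by
  have : NormedAlgebra ℚ (V →L[ℝ] V) := NormedAlgebra.restrictScalars ℚ ℝ _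
  rw [add_smul]
  exact NormedSpace.exp_add_of_commute (((Commute.refl _).smul_left _).smul_right _)

theorem contDiff_exp_smul (T : V →L[ℝ] V) {k : WithTop ℕ∞} :
    ContDiff ℝ k fun s : ℝ => NormedSpace.exp (s • T) := by
  have h : ContDiff ℝ k (NormedSpace.exp : (V →L[ℝ] V) → (V →L[ℝ] V)) :=
    contDiff_iff_contDiffAt.2 fun x => (NormedSpace.exp_analytic (𝕂 := ℝ) x).contDiffAt
  exact h.comp (contDiff_id.smul contDiff_const)

theorem exp_semiconj {L T S : V →L[ℝ] V} (h : ∀ y, L (T y) = S (L y)) (y : V) :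
    L (NormedSpace.exp T y) = NormedSpace.exp S (L y) := by
  have : NormedAlgebra ℚ (V →L[ℝ] V) := NormedAlgebra.restrictScalars ℚ ℝ _
  have h1 : SemiconjBy L T S := ContinuousLinearMap.ext h
  exact congrArg (fun R : V →L[ℝ] V => R y) h1.exp_right

end Exponential

theorem E_eq (s : ℝ) : E B s = NormedSpace.exp (s • -driftCLM B) := by
  let f : Matrix (Coord p) (Coord p) ℝ →ₐ[ℝ] (Space p →L[ℝ] Space p) :=
    AlgHomClass.toAlgHom (Matrix.toEuclideanCLM (n := Coord p) (𝕜 := ℝ))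
  have hc : Continuous f := f.toLinearMap.continuous_of_finiteDimensional
  have h : NormedSpace.exp (f (-s • Bᵀ)) = NormedSpace.exp (s • -driftCLM B) := by
    congr 1
    rw [map_smul]
    exact (neg_smul s (driftCLM B)).trans (smul_neg s (driftCLM B)).symm
  rw [← h]
  open scoped Matrix.Norms.Operator in
  let i1 : NormedAlgebra ℚ (Matrix (Coord p) (Coord p) ℝ) := NormedAlgebra.restrictScalars ℚ ℝ _
  let i2 : Algebra ℚ (Space p →L[ℝ] Space p) := Algebra.restrictScalars ℚ ℝ _
  exact NormedSpace.map_exp f hc (-s • Bᵀ)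

theorem E_zero : E B 0 = 1 := (E_eq 0).trans (exp_zero_smul _)

theorem E_add (s t : ℝ) : E B (s + t) = E B s * E B t := by
  simp only [E_eq]
  exact exp_add_smul _ _ _

theorem E_apply_neg (s : ℝ) (x : Space p) : E B s (E B (-s) x) = x := by
  have := E_add (B := B) s (-s)
  rw [add_neg_cancel, E_zero] at this
  exact (congrArg (fun T : Space p →L[ℝ] Space p => T x) this).symm

theorem E_neg_apply (s : ℝ) (x : Space p) : E B (-s) (E B s x) = x := by
  simpa using E_apply_neg (B := B) (-s) x

theorem hasDerivAt_E (s : ℝ) : HasDerivAt (E B) (-driftCLM B * E B s) s := by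
  have := hasDerivAt_exp_smul_const' (𝕂 := ℝ) (-driftCLM B) s
  rw [← E_eq] at this
  exact this.congr_of_eventuallyEq (.of_forall fun u => E_eq u)

theorem contDiff_E {k : WithTop ℕ∞} : ContDiff ℝ k (E B) := by
  rw [show E B = fun s : ℝ => NormedSpace.exp (s • -driftCLM B) from funext E_eq]
  exact contDiff_exp_smul _

theorem continuous_E : Continuous (E B) := (contDiff_E (k := 0)).continuous

theorem dil_mul (r s : ℝ) (x : Space p) : dil r (dil s x) = dil (r * s) x := by
  ext c; simp [mul_pow, mul_assoc]

theorem dil_one (x : Space p) : dil 1 x = x := by ext c; simp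

theorem dil_inv_apply {r : ℝ} (hr : r ≠ 0) (x : Space p) : dil r (dil r⁻¹ x) = x := by
  rw [dil_mul, mul_inv_cancel₀ hr, dil_one]

theorem inv_dil_apply {r : ℝ} (hr : r ≠ 0) (x : Space p) : dil r⁻¹ (dil r x) = x := by
  rw [dil_mul, inv_mul_cancel₀ hr, dil_one]

/-- A nonzero entry of `B` links block i to block i + 1, whose weights 2i + 1 and 2i + 3 differ by
2: the drift has degree 2, like time. -/
theorem IsDriftMatrix.drift_dil (hB : IsDriftMatrix B) (r : ℝ) (x : Space p) :
    r ^ 2 • driftCLM B (dil r x) = dil r (driftCLM B x) := by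
  ext c
  rw [PiLp.smul_apply, dil_apply, driftCLM_apply, driftCLM_apply, smul_eq_mul, mul_sum, mul_sum]
  refine sum_congr rfl fun d _ => ?_
  by_cases h : B d c = 0
  · simp [h]
  · rw [dil_apply, hB.index_eq h]; ring

theorem IsDriftMatrix.E_dil (hB : IsDriftMatrix B) (r s : ℝ) (x : Space p) :
    E B (r ^ 2 * s) (dil r x) = dil r (E B s x) := by
  rw [E_eq, E_eq]
  refine (exp_semiconj (fun y => ?_) x).symm
  change dil r (s • -driftCLM B y) = (r ^ 2 * s) • -driftCLM B (dil r y)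
  rw [map_smul, map_neg, ← hB.drift_dil, mul_comm, mul_smul, smul_neg, smul_neg, smul_neg]

theorem norm_dil_le {r : ℝ} (hr : 0 ≤ r) (hr1 : r ≤ 1) (x : Space p) : ‖dil r x‖ ≤ r * ‖x‖ := by
  refine le_of_sq_le_sq ?_ (by positivity)
  rw [mul_pow, EuclideanSpace.norm_sq_eq, EuclideanSpace.norm_sq_eq, mul_sum]
  refine sum_le_sum fun c _ => ?_
  rw [dil_apply, norm_mul, mul_pow]
  refine mul_le_mul_of_nonneg_right ?_ (by positivity)
  rw [Real.norm_of_nonneg (by positivity), ← pow_mul]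
  exact pow_le_pow_of_le_one hr hr1 (by omega)

theorem le_norm_dil {r : ℝ} (hr1 : 1 ≤ r) (x : Space p) : r * ‖x‖ ≤ ‖dil r x‖ := by
  have hr : 0 < r := by linarith
  have h := norm_dil_le (inv_nonneg.2 hr.le) (inv_le_one_of_one_le₀ hr1) (dil r x)
  rw [inv_dil_apply hr.ne'] at h
  rwa [← div_eq_inv_mul, le_div_iff₀ hr, mul_comm] at h

theorem sum_weight : ∑ c : Coord p, (2 * (c.1 : ℕ) + 1) = homDim p := by
  rw [Fintype.sum_sigma, homDim]
  simp [mul_comm]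

theorem det_dil (r : ℝ) : (dil r : Space p →L[ℝ] Space p).det = r ^ homDim p := by
  rw [ContinuousLinearMap.det, dil, coe_toEuclideanCLM_eq_toEuclideanLin,
    toEuclideanLin_eq_toLin_orthonormal, LinearMap.det_toLin, det_diagonal, prod_pow_eq_pow_sum,
    sum_weight]

theorem volume_preimage_dil {r : ℝ} (hr : 0 < r) (S : Set (Space p)) :
    volume (dil r ⁻¹' S) = ENNReal.ofReal (r ^ homDim p)⁻¹ * volume S := by
  have hd : (dil r : Space p →L[ℝ] Space p).det ≠ 0 := by rw [det_dil]; positivity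
  have h := Measure.addHaar_preimage_continuousLinearMap volume hd S
  rwa [← ContinuousLinearMap.det, det_dil, abs_of_pos (by positivity)] at h

/-- The map `ζ ↦ z₀ ∘ δ_r ζ`, where `δ_r` is the dilation of space-time. -/
def chart (B : Matrix (Coord p) (Coord p) ℝ) (z₀ : SpaceTime p) (r : ℝ) (ζ : SpaceTime p) :
    SpaceTime p :=
  groupMul B z₀ (dil r ζ.1, r ^ 2 * ζ.2)

theorem chart_apply (z₀ : SpaceTime p) (r : ℝ) (ζ : SpaceTime p) :
    chart B z₀ r ζ = (dil r ζ.1 + E B (r ^ 2 * ζ.2) z₀.1, z₀.2 + r ^ 2 * ζ.2) := rfl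

/-- The inverse of `chart B z₀ r`. -/
def chartInv (B : Matrix (Coord p) (Coord p) ℝ) (z₀ : SpaceTime p) (r : ℝ) (z : SpaceTime p) :
    SpaceTime p :=
  (dil r⁻¹ (z.1 - E B (z.2 - z₀.2) z₀.1), (r ^ 2)⁻¹ * (z.2 - z₀.2))

theorem chart_chartInv (z₀ : SpaceTime p) {r : ℝ} (hr : r ≠ 0) (z : SpaceTime p) :
    chart B z₀ r (chartInv B z₀ r z) = z := by
  rw [chart_apply, chartInv, dil_inv_apply hr, mul_inv_cancel_left₀ (pow_ne_zero 2 hr)]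
  ext1 <;> simp

theorem contDiff_chart (z₀ : SpaceTime p) (r : ℝ) {k : WithTop ℕ∞} :
    ContDiff ℝ k (chart B z₀ r) := by
  have h1 : ContDiff ℝ k fun ζ : SpaceTime p => E B (r ^ 2 * ζ.2) :=
    contDiff_E.comp (contDiff_const.mul contDiff_snd)
  exact (((dil r).contDiff.comp contDiff_fst).add (h1.clm_apply contDiff_const)).prodMk
    (contDiff_const.add (contDiff_const.mul contDiff_snd))

theorem continuous_chart (z₀ : SpaceTime p) (r : ℝ) : Continuous (chart B z₀ r) :=
  (contDiff_chart z₀ r (k := 0)).continuous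

/-- The inverse of left translation is the translation by the inverse element. -/
theorem chartInv_one (ζ : SpaceTime p) :
    chartInv B ζ 1 = chart B (-(E B (-ζ.2) ζ.1), -ζ.2) 1 := by
  funext z
  rw [chart_apply, chartInv]
  ext1
  · simp only [inv_one, dil_one, one_pow, one_mul, map_neg, sub_eq_add_neg]
    rw [E_add]; rfl
  · simp; ring

theorem continuous_chartInv_uncurry :
    Continuous fun q : SpaceTime p × SpaceTime p => chartInv B q.2 1 q.1 := by
  have h1 : Continuous fun q : SpaceTime p × SpaceTime p => E B (q.1.2 - q.2.2) q.2.1 :=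
    (continuous_E.comp (by fun_prop : Continuous fun q : SpaceTime p × SpaceTime p =>
      q.1.2 - q.2.2)).clm_apply (by fun_prop)
  exact ((dil _).continuous.comp ((by fun_prop : Continuous fun q : SpaceTime p × SpaceTime p =>
    q.1.1).sub h1)).prodMk (by fun_prop)

theorem lintegral_affine {r : ℝ} (hr : 0 < r) (t₀ : ℝ) (f : ℝ → ENNReal) (hf : Measurable f) :
    ∫⁻ τ, f (t₀ + r * τ) = ENNReal.ofReal r⁻¹ * ∫⁻ t, f t := by
  have h1 : ∫⁻ t, f t = ∫⁻ t, f (t₀ + t) := (lintegral_add_left_eq_self f t₀).symm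
  have h2 := Real.map_volume_mul_left hr.ne'
  have h3 : ∫⁻ τ, f (t₀ + r * τ) = ∫⁻ t, f (t₀ + t) ∂(Measure.map (r * ·) volume) :=
    (lintegral_map (hf.comp (measurable_const_add t₀)) (measurable_const_mul r)).symm
  rw [h3, h2, lintegral_smul_measure, h1, abs_of_pos (inv_pos.2 hr), smul_eq_mul]

theorem volume_preimage_chart (z₀ : SpaceTime p) {r : ℝ} (hr : 0 < r) {S : Set (SpaceTime p)}
    (hS : MeasurableSet S) :
    volume (chart B z₀ r ⁻¹' S) = ENNReal.ofReal (r ^ (homDim p + 2))⁻¹ * volume S := by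
  rw [Measure.volume_eq_prod, Measure.prod_apply_symm
    ((continuous_chart z₀ r).measurable hS), Measure.prod_apply_symm hS]
  have h1 : ∀ τ : ℝ, volume ((fun x : Space p => (x, τ)) ⁻¹' (chart B z₀ r ⁻¹' S)) =
      ENNReal.ofReal (r ^ homDim p)⁻¹ * volume ((fun x : Space p => (x, z₀.2 + r ^ 2 * τ)) ⁻¹' S) := by
    intro τ
    have : (fun x : Space p => (x, τ)) ⁻¹' (chart B z₀ r ⁻¹' S) = dil r ⁻¹'
        ((fun x => x + E B (r ^ 2 * τ) z₀.1) ⁻¹' ((fun x : Space p => (x, z₀.2 + r ^ 2 * τ)) ⁻¹' S)) :=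
      rfl
    rw [this, volume_preimage_dil hr, measure_preimage_add_right]
  simp_rw [h1]
  have hm : Measurable fun t : ℝ => volume ((fun x : Space p => (x, t)) ⁻¹' S) :=
    measurable_measure_prodMk_right hS
  have hm' : Measurable fun τ : ℝ =>
      volume ((fun x : Space p => (x, z₀.2 + r ^ 2 * τ)) ⁻¹' S) :=
    hm.comp (by fun_prop : Measurable fun τ : ℝ => z₀.2 + r ^ 2 * τ)
  rw [lintegral_const_mul _ hm',
    lintegral_affine (by positivity : 0 < r ^ 2) z₀.2 _ hm, ← mul_assoc,
    ← ENNReal.ofReal_mul (by positivity), pow_add, mul_inv]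

theorem hasFDerivAt_chart (z₀ : SpaceTime p) (r : ℝ) (ζ : SpaceTime p) :
    ∃ D : SpaceTime p →L[ℝ] SpaceTime p, HasFDerivAt (chart B z₀ r) D ζ ∧
      (∀ v, D (v, 0) = (dil r v, 0)) ∧
      D (0, 1) = (-(r ^ 2) • driftCLM B (E B (r ^ 2 * ζ.2) z₀.1), r ^ 2) := by
  have hd := ((contDiff_chart (B := B) z₀ r (k := 1)).differentiable one_ne_zero) ζ
  refine ⟨_, hd.hasFDerivAt, fun v => ?_, ?_⟩
  · have h1 : HasDerivAt (fun s : ℝ => ζ + s • (v, (0 : ℝ))) (v, 0) 0 := by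
      simpa using ((hasDerivAt_id (0 : ℝ)).smul_const (v, (0 : ℝ))).const_add ζ
    have h0 : HasFDerivAt (chart B z₀ r) (fderiv ℝ (chart B z₀ r) ζ)
        (ζ + (0 : ℝ) • (v, (0 : ℝ))) := by
      simpa using hd.hasFDerivAt
    have h2 := h0.comp_hasDerivAt 0 h1
    refine h2.unique ?_
    have h3 : chart B z₀ r ∘ (fun s : ℝ => ζ + s • (v, (0 : ℝ))) =
        fun s : ℝ => chart B z₀ r ζ + s • (dil r v, (0 : ℝ)) := by
      funext s
      simp only [Function.comp, chart_apply]
      ext1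
      · simp; abel
      · simp
    rw [h3]
    simpa using ((hasDerivAt_id (0 : ℝ)).smul_const (dil r v, (0 : ℝ))).const_add (chart B z₀ r ζ)
  · have h1 : HasDerivAt (fun s : ℝ => ζ + s • ((0 : Space p), (1 : ℝ))) (0, 1) 0 := by
      simpa using ((hasDerivAt_id (0 : ℝ)).smul_const ((0 : Space p), (1 : ℝ))).const_add ζ
    have h0 : HasFDerivAt (chart B z₀ r) (fderiv ℝ (chart B z₀ r) ζ)
        (ζ + (0 : ℝ) • ((0 : Space p), (1 : ℝ))) := by
      simpa using hd.hasFDerivAt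
    have h2 := h0.comp_hasDerivAt 0 h1
    refine h2.unique ?_
    have h3 : chart B z₀ r ∘ (fun s : ℝ => ζ + s • ((0 : Space p), (1 : ℝ))) =
        fun s : ℝ => (dil r ζ.1 + E B (r ^ 2 * (ζ.2 + s)) z₀.1, z₀.2 + r ^ 2 * (ζ.2 + s)) := by
      funext s
      simp [chart_apply]
    rw [h3]
    have h4 : HasDerivAt (fun s : ℝ => r ^ 2 * (ζ.2 + s)) (r ^ 2) 0 := by
      simpa using ((hasDerivAt_id (0 : ℝ)).const_add ζ.2).const_mul (r ^ 2)
    have h5 := (hasDerivAt_E (B := B) (r ^ 2 * (ζ.2 + 0))).scomp (0 : ℝ) h4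
    have h6 : HasDerivAt (fun s : ℝ => E B (r ^ 2 * (ζ.2 + s)) z₀.1)
        (-(r ^ 2) • driftCLM B (E B (r ^ 2 * ζ.2) z₀.1)) 0 := by
      have := h5.clm_apply (hasDerivAt_const (0 : ℝ) z₀.1)
      simpa using this
    exact (h6.const_add (dil r ζ.1)).prodMk (h4.const_add z₀.2)

/-! ### Calculus of the operator and its invariance -/

/-- The unit vector of space-time in the spatial direction `i`. -/
def spaceDir (i : Coord p) : SpaceTime p := (EuclideanSpace.single i 1, 0)

theorem eventually_differentiableAt (hu : ContDiffAt ℝ 2 u z) :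
    ∀ᶠ y in 𝓝 z, DifferentiableAt ℝ u y :=
  (hu.eventually (by simp)).mono fun _ hy => hy.differentiableAt two_ne_zero

theorem differentiableAt_fderiv (hu : ContDiffAt ℝ 2 u z) : DifferentiableAt ℝ (fderiv ℝ u) z :=
  (hu.fderiv_right (m := 1) (by norm_num)).differentiableAt one_ne_zero

theorem differentiableAt_dx (hu : ContDiffAt ℝ 2 u z) (j : Coord p) :
    DifferentiableAt ℝ (dx j u) z :=
  (differentiableAt_fderiv hu).clm_apply (differentiableAt_const _)

theorem hess_eq (hu : ContDiffAt ℝ 2 u z) (i j : Coord p) :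
    hess u z i j = fderiv ℝ (fderiv ℝ u) z (spaceDir i) (spaceDir j) := by
  have h := (differentiableAt_fderiv hu).hasFDerivAt.clm_apply
    (hasFDerivAt_const (spaceDir j) z)
  change fderiv ℝ (fun y => fderiv ℝ u y (spaceDir j)) z (spaceDir i) = _
  rw [h.fderiv]
  simp

theorem operatorL_congr (h : u =ᶠ[𝓝 z] v) : operatorL B A u z = operatorL B A v z := by
  have h1 : grad u z = grad v z := by
    funext i; rw [grad, grad, dx, dx, h.fderiv_eq]
  have h2 : hess u z = hess v z := by
    ext i j
    have : dx j u =ᶠ[𝓝 z] dx j v := h.fderiv.mono fun y hy => by rw [dx, dx, hy]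
    simp only [hess, of_apply]
    rw [dx, dx, this.fderiv_eq]
  rw [operatorL, operatorL, h1, h2, dt, dt, h.fderiv_eq]

theorem operatorL_add (hu : ContDiffAt ℝ 2 u z) (hv : ContDiffAt ℝ 2 v z) :
    operatorL B A (u + v) z = operatorL B A u z + operatorL B A v z := by
  have hf : fderiv ℝ (u + v) =ᶠ[𝓝 z] fderiv ℝ u + fderiv ℝ v := by
    filter_upwards [eventually_differentiableAt hu, eventually_differentiableAt hv] with y h1 h2
    exact fderiv_add h1 h2
  have h1 : grad (u + v) z = grad u z + grad v z := by
    funext i; simp only [grad, dx, Pi.add_apply, hf.eq_of_nhds]; rfl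
  have h2 : hess (u + v) z = hess u z + hess v z := by
    ext i j
    rw [Matrix.add_apply, hess_eq (u := u + v) (hu.add hv), hess_eq hu, hess_eq hv, hf.fderiv_eq,
      fderiv_add (differentiableAt_fderiv hu) (differentiableAt_fderiv hv)]
    rfl
  have h3 : dt (u + v) z = dt u z + dt v z := by
    simp only [dt, hf.eq_of_nhds]; rfl
  simp only [operatorL, h1, h2, h3, Matrix.mul_add, trace_add, mulVec_add, dotProduct_add]
  ring

theorem operatorL_const_mul (c : ℝ) (hu : ContDiffAt ℝ 2 u z) :
    operatorL B A (fun y => c * u y) z = c * operatorL B A u z := by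
  have hf : fderiv ℝ (fun y => c * u y) =ᶠ[𝓝 z] fun y => c • fderiv ℝ u y := by
    filter_upwards [eventually_differentiableAt hu] with y h1
    exact fderiv_const_mul h1 c
  have h1 : grad (fun y => c * u y) z = c • grad u z := by
    funext i; simp only [grad, dx, Pi.smul_apply, hf.eq_of_nhds]; rfl
  have h2 : hess (fun y => c * u y) z = c • hess u z := by
    ext i j
    rw [Matrix.smul_apply, hess_eq (contDiffAt_const.mul hu), hess_eq hu, hf.fderiv_eq,
      fderiv_fun_const_smul (differentiableAt_fderiv hu)]
    rfl
  have h3 : dt (fun y => c * u y) z = c * dt u z := by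
    simp only [dt, hf.eq_of_nhds]; rfl
  simp only [operatorL, h1, h2, h3, Matrix.mul_smul, trace_smul, mulVec_smul, dotProduct_smul,
    smul_eq_mul]
  ring

theorem operatorL_zero : operatorL B A (fun _ => 0) z = 0 := by
  have := operatorL_const_mul (B := B) (A := A) (z := z) (u := fun _ => 0) 0 contDiffAt_const
  simpa using this

theorem operatorL_const (c : ℝ) : operatorL B A (fun _ => c) z = 0 := by
  have hg : grad (fun _ : SpaceTime p => c) z = 0 := by funext i; simp [grad, dx]
  have hh : hess (fun _ : SpaceTime p => c) z = 0 := by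
    ext i j
    have : dx j (fun _ : SpaceTime p => c) = fun _ => 0 := by funext y; simp [dx]
    simp only [hess, of_apply, this]
    simp [dx]
  simp [operatorL, hg, hh, dt]

theorem operatorL_time : operatorL B A (fun y => y.2) z = -1 := by
  have hf : ∀ y : SpaceTime p, fderiv ℝ (fun y : SpaceTime p => y.2) y =
      ContinuousLinearMap.snd ℝ (Space p) ℝ := fun y => fderiv_snd
  have hd : ∀ j, dx j (fun y : SpaceTime p => y.2) = fun _ => 0 := fun j => by
    funext y; simp [dx, hf]
  have hg : grad (fun y : SpaceTime p => y.2) z = 0 := by funext i; simp [grad, hd]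
  have hh : hess (fun y : SpaceTime p => y.2) z = 0 := by
    ext i j
    simp only [hess, of_apply, hd]
    simp [dx]
  simp [operatorL, hg, hh, dt, hf]

theorem operatorL_sum {ι : Type*} (s : Finset ι) (f : ι → SpaceTime p → ℝ)
    (hf : ∀ i ∈ s, ContDiffAt ℝ 2 (f i) z) :
    operatorL B A (fun y => ∑ i ∈ s, f i y) z = ∑ i ∈ s, operatorL B A (f i) z := by
  classical
  induction s using Finset.induction_on with
  | empty => simpa using operatorL_zero
  | insert a s ha ih =>
    have h1 : (fun y => ∑ i ∈ insert a s, f i y) = f a + fun y => ∑ i ∈ s, f i y := by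
      funext y; simp [sum_insert ha]
    rw [h1, operatorL_add (hf a (mem_insert_self _ _))
      (ContDiffAt.sum fun i hi => hf i (mem_insert_of_mem hi)), sum_insert ha,
      ih fun i hi => hf i (mem_insert_of_mem hi)]

theorem dx_eq_of_hasDerivAt (hu : DifferentiableAt ℝ u z) (i : Coord p) {a : ℝ}
    (h : HasDerivAt (fun s : ℝ => u (z + s • spaceDir i)) a 0) : dx i u z = a := by
  have h1 : HasDerivAt (fun s : ℝ => z + s • spaceDir i) (spaceDir i) 0 := by
    simpa using ((hasDerivAt_id (0 : ℝ)).smul_const (spaceDir i)).const_add z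
  have h0 : HasFDerivAt u (fderiv ℝ u z) (z + (0 : ℝ) • spaceDir i) := by simpa using hu.hasFDerivAt
  exact (h0.comp_hasDerivAt 0 h1).unique h

theorem dt_eq_of_hasDerivAt (hu : DifferentiableAt ℝ u z) {a : ℝ}
    (h : HasDerivAt (fun s : ℝ => u (z.1, s)) a z.2) : dt u z = a := by
  have h1 : HasDerivAt (fun s : ℝ => (z.1, s)) ((0 : Space p), (1 : ℝ)) z.2 :=
    (hasDerivAt_const z.2 z.1).prodMk (hasDerivAt_id z.2)
  exact (hu.hasFDerivAt.comp_hasDerivAt (f := fun s : ℝ => (z.1, s)) z.2 h1).unique h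

theorem operatorL_exp {f : SpaceTime p → ℝ} (hf : ContDiffAt ℝ 2 f z) :
    operatorL B A (fun y => Real.exp (f y)) z =
      Real.exp (f z) * (grad f z ⬝ᵥ (A z).mulVec (grad f z) + operatorL B A f z) := by
  have he : ∀ᶠ y in 𝓝 z, fderiv ℝ (fun y => Real.exp (f y)) y = Real.exp (f y) • fderiv ℝ f y := by
    filter_upwards [eventually_differentiableAt hf] with y hy
    exact fderiv_exp hy
  have h1 : grad (fun y => Real.exp (f y)) z = Real.exp (f z) • grad f z := by
    funext i; simp only [grad, dx, Pi.smul_apply, he.self_of_nhds]; rfl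
  have h2 : hess (fun y => Real.exp (f y)) z =
      Real.exp (f z) • (vecMulVec (grad f z) (grad f z) + hess f z) := by
    ext i j
    have h3 : dx j (fun y => Real.exp (f y)) =ᶠ[𝓝 z] fun y => Real.exp (f y) * dx j f y :=
      he.mono fun y hy => by rw [dx, hy]; rfl
    have h4 := (hf.differentiableAt two_ne_zero).hasFDerivAt.exp.mul
      (differentiableAt_dx hf j).hasFDerivAt
    have h5 : hess (fun y => Real.exp (f y)) z i j =
        fderiv ℝ (fun y => Real.exp (f y) * dx j f y) z (spaceDir i) := by
      rw [← h3.fderiv_eq]; rfl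
    rw [h5, HasFDerivAt.fderiv (f := fun y => Real.exp (f y) * dx j f y) h4]
    change Real.exp (f z) * dx i (dx j f) z + dx j f z * (Real.exp (f z) * dx i f z) =
      Real.exp (f z) * (dx i f z * dx j f z + dx i (dx j f) z)
    ring
  have h3 : dt (fun y => Real.exp (f y)) z = Real.exp (f z) * dt f z := by
    simp only [dt, he.self_of_nhds]; rfl
  have h4 : (A z * vecMulVec (grad f z) (grad f z)).trace =
      grad f z ⬝ᵥ (A z).mulVec (grad f z) := by
    rw [mul_vecMulVec, trace_vecMulVec, dotProduct_comm]
  simp only [operatorL, h1, h2, h3, Matrix.mul_smul, Matrix.mul_add, trace_smul, trace_add,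
    mulVec_smul, dotProduct_smul, smul_eq_mul, h4]
  ring

theorem dx_comp_chart {z₀ : SpaceTime p} {r : ℝ} (hu : DifferentiableAt ℝ u (chart B z₀ r z))
    (j : Coord p) :
    dx j (u ∘ chart B z₀ r) z = r ^ (2 * (j.1 : ℕ) + 1) * dx j u (chart B z₀ r z) := by
  obtain ⟨D, hD, hD1, -⟩ := hasFDerivAt_chart (B := B) z₀ r z
  have h1 : dil r (EuclideanSpace.single j 1 : Space p) =
      r ^ (2 * (j.1 : ℕ) + 1) • EuclideanSpace.single j (1 : ℝ) := by
    ext c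
    rw [dil_apply, PiLp.smul_apply, smul_eq_mul]
    by_cases h : c = j
    · rw [h]
    · simp [h]
  rw [dx, (hu.hasFDerivAt.comp z hD).fderiv, ContinuousLinearMap.comp_apply, hD1, h1, dx]
  rw [show ((r ^ (2 * (j.1 : ℕ) + 1) • EuclideanSpace.single j (1 : ℝ), 0) : SpaceTime p) =
    r ^ (2 * (j.1 : ℕ) + 1) • (EuclideanSpace.single j (1 : ℝ), 0) by simp, map_smul, smul_eq_mul]

theorem hess_comp_chart {z₀ : SpaceTime p} {r : ℝ} (hu : ContDiffAt ℝ 2 u (chart B z₀ r z))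
    (i j : Coord p) :
    hess (u ∘ chart B z₀ r) z i j =
      r ^ (2 * (i.1 : ℕ) + 1) * r ^ (2 * (j.1 : ℕ) + 1) * hess u (chart B z₀ r z) i j := by
  have h1 : dx j (u ∘ chart B z₀ r) =ᶠ[𝓝 z]
      fun y => r ^ (2 * (j.1 : ℕ) + 1) * (dx j u ∘ chart B z₀ r) y := by
    have := (continuous_chart (B := B) z₀ r).continuousAt.eventually
      (eventually_differentiableAt hu)
    exact this.mono fun y hy => dx_comp_chart hy j
  have hd := differentiableAt_dx hu j
  have hd2 : DifferentiableAt ℝ (dx j u ∘ chart B z₀ r) z :=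
    hd.comp z ((contDiff_chart z₀ r (k := 1)).differentiable one_ne_zero z)
  change fderiv ℝ (dx j (u ∘ chart B z₀ r)) z (spaceDir i) = _
  rw [h1.fderiv_eq, fderiv_const_mul hd2]
  change r ^ (2 * (j.1 : ℕ) + 1) * dx i (dx j u ∘ chart B z₀ r) z = _
  rw [dx_comp_chart hd]
  simp only [hess, of_apply]
  ring

/-- The operator is invariant under left translations and homogeneous under dilations. -/
theorem IsDriftMatrix.operatorL_comp_chart (hB : IsDriftMatrix B) {z₀ : SpaceTime p} {r : ℝ}
    {A' : SpaceTime p → Matrix (Coord p) (Coord p) ℝ} (hA' : A' z = A (chart B z₀ r z))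
    (hA : ∀ i k : Fin (n + 1), ¬(i = 0 ∧ k = 0) → block (A' z) i k = 0)
    (hu : ContDiffAt ℝ 2 u (chart B z₀ r z)) :
    operatorL B A' (u ∘ chart B z₀ r) z = r ^ 2 * operatorL B A u (chart B z₀ r z) := by
  have hd := hu.differentiableAt two_ne_zero
  set w := chart B z₀ r z with hw
  -- Only second derivatives in block 0 enter, each direction of weight 1, hence the factor r².
  have h1 : (A' z * hess (u ∘ chart B z₀ r) z).trace = r ^ 2 * (A w * hess u w).trace := by
    rw [← hA', trace, trace, mul_sum]
    refine sum_congr rfl fun i _ => ?_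
    rw [diag_apply, diag_apply, Matrix.mul_apply, Matrix.mul_apply, mul_sum]
    refine sum_congr rfl fun j _ => ?_
    rw [hess_comp_chart hu]
    by_cases h : i.1 = 0 ∧ j.1 = 0
    · rw [h.1, h.2]; simp; ring
    · have : A' z i j = 0 := congrFun (congrFun (hA i.1 j.1 h) i.2) j.2
      simp [this]
  have h2 : (z.1 : Coord p → ℝ) ⬝ᵥ B.mulVec (grad (u ∘ chart B z₀ r) z) =
      r ^ 2 * ((dil r z.1 : Coord p → ℝ) ⬝ᵥ B.mulVec (grad u w)) := by
    simp only [dotProduct, mulVec, mul_sum]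
    refine sum_congr rfl fun i _ => sum_congr rfl fun j _ => ?_
    by_cases h : B i j = 0
    · simp [h]
    · rw [grad, dx_comp_chart hd, dil_apply, hB.index_eq h, grad]; ring
  obtain ⟨D, hD, -, hD2⟩ := hasFDerivAt_chart (B := B) z₀ r z
  have hlin : ∀ y : Space p, fderiv ℝ u w (y, 0) = (y : Coord p → ℝ) ⬝ᵥ grad u w := by
    intro y
    have : (y, (0 : ℝ)) = ∑ i, y i • (spaceDir i : SpaceTime p) := by
      ext1
      · ext c; simp [spaceDir, Prod.fst_sum, Pi.single_apply]
      · simp [spaceDir, Prod.snd_sum]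
    rw [this, map_sum]
    simp only [map_smul, smul_eq_mul, dotProduct]
    rfl
  -- Differentiating E(r²τ)x₀ in time produces exactly the drift at the translated part of the
  -- point; it completes `dil r z.1` to the full position of `w`.
  have h3 : dt (u ∘ chart B z₀ r) z =
      r ^ 2 * (dt u w - (E B (r ^ 2 * z.2) z₀.1 : Coord p → ℝ) ⬝ᵥ B.mulVec (grad u w)) := by
    rw [dt, (hd.hasFDerivAt.comp z hD).fderiv, ContinuousLinearMap.comp_apply, hD2]
    have e : ((-(r ^ 2) • driftCLM B (E B (r ^ 2 * z.2) z₀.1), r ^ 2) : SpaceTime p) =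
        r ^ 2 • ((0, 1) - (driftCLM B (E B (r ^ 2 * z.2) z₀.1), 0)) := by
      ext1 <;> simp
    rw [e, map_smul, map_sub, hlin, smul_eq_mul]
    congr 2
    rw [dotProduct_mulVec, ← mulVec_transpose]
    rfl
  have h4 : (w.1 : Coord p → ℝ) = dil r z.1 + E B (r ^ 2 * z.2) z₀.1 := rfl
  rw [operatorL, h1, h2, h3, operatorL, h4, add_dotProduct]
  ring

/-! ### Minimum principle -/

theorem trace_mul_nonneg {ι : Type*} [Fintype ι] {X H : Matrix ι ι ℝ}
    (hX : X.PosSemidef) (hH : ∀ v : ι → ℝ, 0 ≤ v ⬝ᵥ H.mulVec v) : 0 ≤ (X * H).trace := by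
  obtain ⟨m, y, rfl⟩ := posSemidef_iff_eq_sum_vecMulVec.1 hX
  rw [Matrix.sum_mul, trace_sum]
  refine sum_nonneg fun k _ => ?_
  rw [trace_mul_comm, mul_vecMulVec, trace_vecMulVec, star_trivial, dotProduct_comm]
  exact hH _

/-- A negative second derivative would make 0 a local maximum as well, so f would be locally
constant with zero second derivative. -/
theorem deriv_deriv_nonneg_of_isLocalMin {f : ℝ → ℝ} (hm : IsLocalMin f 0)
    (hc : ContinuousAt f 0) : 0 ≤ deriv (deriv f) 0 := by
  by_contra! hneg
  have hmax := isLocalMax_of_deriv_deriv_neg hneg hm.deriv_eq_zero hc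
  have hconst : f =ᶠ[𝓝 0] fun _ => f 0 := by
    filter_upwards [hm, hmax] with s h1 h2 using le_antisymm h2 h1
  rw [hconst.deriv.deriv_eq] at hneg
  simp at hneg

/-- At a minimum over the past, the operator is nonnegative. -/
theorem operatorL_nonneg_of_min (hA : (A z).PosSemidef) (hu : ContDiffAt ℝ 2 u z)
    (hmin : ∀ᶠ y in 𝓝 z, y.2 ≤ z.2 → u z ≤ u y) : 0 ≤ operatorL B A u z := by
  have hdu := hu.differentiableAt two_ne_zero
  have hline : ∀ a : SpaceTime p, ∀ s : ℝ, HasDerivAt (fun s : ℝ => z + s • a) a s := fun a s => by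
    simpa using ((hasDerivAt_id s).smul_const a).const_add z
  have hz0 : ∀ a : SpaceTime p, z + (0 : ℝ) • a = z := fun a => by simp
  have hlc : ∀ a : SpaceTime p, Tendsto (fun s : ℝ => z + s • a) (𝓝 0) (𝓝 z) := fun a => by
    have := (hline a 0).continuousAt.tendsto
    rwa [hz0] at this
  have hcont : ∀ a : SpaceTime p, ContinuousAt (fun s : ℝ => u (z + s • a)) 0 := fun a => by
    rw [ContinuousAt, hz0]
    exact hu.continuousAt.tendsto.comp (hlc a)
  have hloc : ∀ x : Space p, IsLocalMin (fun s : ℝ => u (z + s • (x, (0 : ℝ)))) 0 := by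
    intro x
    filter_upwards [(hlc (x, 0)).eventually hmin] with s hs
    rw [hz0]
    exact hs (by simp)
  have hder : ∀ a : SpaceTime p,
      deriv (fun s : ℝ => u (z + s • a)) =ᶠ[𝓝 0] fun s => fderiv ℝ u (z + s • a) a := by
    intro a
    filter_upwards [(hlc a).eventually (eventually_differentiableAt hu)] with s hs
    exact (hs.hasFDerivAt.comp_hasDerivAt s (hline a s)).deriv
  have hgrad : grad u z = 0 := by
    funext i
    have h1 := (hloc (EuclideanSpace.single i 1)).deriv_eq_zero
    rw [(hder _).eq_of_nhds, hz0] at h1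
    exact h1
  have hhess : ∀ x : Coord p → ℝ, 0 ≤ x ⬝ᵥ (hess u z).mulVec x := by
    intro x
    set a : SpaceTime p := (WithLp.toLp 2 x, 0) with ha
    have h1 := deriv_deriv_nonneg_of_isLocalMin (hloc (WithLp.toLp 2 x))
      (hcont a)
    have h0 : HasFDerivAt (fderiv ℝ u) (fderiv ℝ (fderiv ℝ u) z) (z + (0 : ℝ) • a) := by
      rw [hz0]; exact (differentiableAt_fderiv hu).hasFDerivAt
    have h2 : HasDerivAt (fun s : ℝ => fderiv ℝ u (z + s • a) a)
        (fderiv ℝ (fderiv ℝ u) z a a) 0 := by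
      have h3 := h0.comp_hasDerivAt 0 (hline a 0)
      have h4 := h3.clm_apply (hasDerivAt_const (0 : ℝ) a)
      rwa [map_zero, add_zero] at h4
    rw [(hder a).deriv_eq, h2.deriv] at h1
    have h3 : a = ∑ i, x i • (spaceDir i : SpaceTime p) := by
      ext1
      · ext c; simp [ha, spaceDir, Prod.fst_sum, Pi.single_apply]
      · simp [ha, spaceDir, Prod.snd_sum]
    rw [h3] at h1
    simp only [map_sum, map_smul, _root_.sum_apply, _root_.smul_apply,
      smul_eq_mul] at h1
    convert h1 using 1
    simp only [dotProduct, mulVec, mul_sum, hess_eq hu]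
    rw [sum_comm]
    exact sum_congr rfl fun i _ => sum_congr rfl fun j _ => by ring
  have htime : dt u z ≤ 0 := by
    have h1 : HasDerivAt (fun s : ℝ => u (z + s • ((0 : Space p), (1 : ℝ)))) (dt u z) 0 := by
      have h0 : HasFDerivAt u (fderiv ℝ u z) (z + (0 : ℝ) • ((0 : Space p), (1 : ℝ))) := by
        rw [hz0]; exact hdu.hasFDerivAt
      exact h0.comp_hasDerivAt 0 (hline _ 0)
    -- Only the past is compared with z, so the sign of the time derivative comes from difference
    -- quotients with negative increment.
    refine le_of_tendsto (h1.tendsto_slope_zero_left) ?_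
    have h2 : ∀ᶠ s : ℝ in 𝓝[<] 0, _ := nhdsWithin_le_nhds ((hlc ((0 : Space p), (1 : ℝ))).eventually hmin)
    filter_upwards [h2, self_mem_nhdsWithin] with s hs hs0
    have hs0 : s < 0 := hs0
    have h3 := hs (by simpa using hs0.le)
    simp only [zero_add, zero_smul, add_zero, smul_eq_mul]
    exact mul_nonpos_of_nonpos_of_nonneg (inv_nonpos.2 hs0.le) (sub_nonneg.2 h3)
  have h := trace_mul_nonneg hA hhess
  rw [operatorL, hgrad, mulVec_zero, dotProduct_zero]
  linarith

/-! ### Ellipticity on the whole space and the explicit subsolution -/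

/-- The pointwise conditions on the coefficient matrix, in terms of forms on `ℝ^N`. -/
structure IsElliptic (lam Lam : ℝ) (X : Matrix (Coord p) (Coord p) ℝ) : Prop where
  posSemidef : X.PosSemidef
  block_eq_zero : ∀ i k : Fin (n + 1), ¬(i = 0 ∧ k = 0) → block X i k = 0
  lower : ∀ v : Coord p → ℝ, lam * (v ⬝ᵥ (projZero p).mulVec v) ≤ v ⬝ᵥ X.mulVec v
  upper : ∀ v : Coord p → ℝ, v ⬝ᵥ X.mulVec v ≤ Lam * (v ⬝ᵥ (projZero p).mulVec v)

theorem IsElliptic.index_eq {lam Lam : ℝ} {X : Matrix (Coord p) (Coord p) ℝ}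
    (hX : IsElliptic lam Lam X) {c d : Coord p} (h : X c d ≠ 0) : c.1 = 0 ∧ d.1 = 0 := by
  by_contra hne
  exact h (congrFun (congrFun (hX.block_eq_zero c.1 d.1 hne) c.2) d.2)

theorem IsCoefficient.isElliptic {Ω : Set (SpaceTime p)} {lam Lam : ℝ} (hlam : 0 < lam)
    (hA : IsCoefficient Ω lam Lam A) (hz : z ∈ Ω) : IsElliptic lam Lam (A z) := by
  have h1 : ∀ v : Coord p → ℝ, v ⬝ᵥ (A z).mulVec v =
      (fun a => v ⟨0, a⟩) ⬝ᵥ (block (A z) 0 0).mulVec (fun a => v ⟨0, a⟩) := by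
    intro v
    rw [dotProduct, Fintype.sum_sigma, sum_eq_single 0]
    · refine sum_congr rfl fun a _ => ?_
      congr 1
      rw [mulVec, dotProduct, Fintype.sum_sigma, sum_eq_single 0]
      · rfl
      · intro k _ hk
        refine sum_eq_zero fun b _ => ?_
        have : A z ⟨0, a⟩ ⟨k, b⟩ = 0 :=
          congrFun (congrFun (hA.block_eq_zero z hz 0 k (by simp [hk])) a) b
        rw [this, zero_mul]
      · simp
    · intro i _ hi
      refine sum_eq_zero fun a _ => ?_
      have : (A z).mulVec v ⟨i, a⟩ = 0 := by
        refine sum_eq_zero fun d _ => ?_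
        have : A z ⟨i, a⟩ d = 0 :=
          congrFun (congrFun (hA.block_eq_zero z hz i d.1 (by simp [hi])) a) d.2
        exact mul_eq_zero_of_left this _
      rw [this, mul_zero]
    · simp
  have h2 : ∀ v : Coord p → ℝ, v ⬝ᵥ (projZero p).mulVec v =
      (fun a => v ⟨0, a⟩) ⬝ᵥ (fun a => v ⟨0, a⟩) := by
    intro v
    rw [dotProduct, Fintype.sum_sigma, sum_eq_single 0]
    · refine sum_congr rfl fun a _ => ?_
      simp [projZero, mulVec_diagonal]
    · intro i _ hi
      refine sum_eq_zero fun a _ => ?_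
      simp [projZero, mulVec_diagonal, hi]
    · simp
  have hlow : ∀ v : Coord p → ℝ, lam * (v ⬝ᵥ (projZero p).mulVec v) ≤ v ⬝ᵥ (A z).mulVec v :=
    fun v => by rw [h1, h2]; exact hA.lower z hz _
  refine ⟨.of_dotProduct_mulVec_nonneg ?_ fun v => ?_, hA.block_eq_zero z hz, hlow, fun v => ?_⟩
  · rw [IsHermitian, conjTranspose_eq_transpose_of_trivial]
    exact hA.isSymm z hz
  · rw [star_trivial]
    refine le_trans (mul_nonneg hlam.le ?_) (hlow v)
    rw [h2]
    exact sum_nonneg fun a _ => mul_self_nonneg _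
  · rw [h1, h2]; exact hA.upper z hz _

/-- The matrix `C⁻¹ / (4λ)` of the quadratic form in the kernel. -/
def precision (B : Matrix (Coord p) (Coord p) ℝ) (lam : ℝ) : Matrix (Coord p) (Coord p) ℝ :=
  (1 / (4 * lam)) • (covariance B)⁻¹

theorem precision_transpose (lam : ℝ) : (precision B lam)ᵀ = precision B lam := by
  rw [precision, transpose_smul, transpose_nonsing_inv, covariance_transpose]

theorem precision_symm (lam : ℝ) (c d : Coord p) : precision B lam c d = precision B lam d c :=
  congrFun (congrFun (precision_transpose (B := B) lam) d) c

theorem IsDriftMatrix.precision_posDef (hB : IsDriftMatrix B) {lam : ℝ} (hlam : 0 < lam) :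
    (precision B lam).PosDef :=
  hB.covariance_posDef.inv.smul (by positivity)

/-- The Riccati equation of the precision matrix. -/
theorem IsDriftMatrix.riccati (hB : IsDriftMatrix B) {lam : ℝ} (hlam : 0 < lam)
    (y : Coord p → ℝ) :
    y ⬝ᵥ (B + degreeMatrix p).mulVec ((precision B lam).mulVec y) =
      2 * lam * ((precision B lam).mulVec y ⬝ᵥ
        (projZero p).mulVec ((precision B lam).mulVec y)) := by
  have hu : IsUnit (covariance B).det :=
    (Matrix.isUnit_iff_isUnit_det _).1 hB.covariance_posDef.isUnit
  set η := (precision B lam).mulVec y with hη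
  -- Inverting the definition of η turns the left side into the covariance form; the symmetric part
  -- of C(B + D), D the degree matrix, is I₀/2 by the Lyapunov equation.
  have hy : y = (4 * lam) • (covariance B).mulVec η := by
    rw [hη, precision, smul_mulVec, mulVec_smul, smul_smul, mulVec_mulVec, mul_nonsing_inv _ hu,
      one_mulVec, mul_one_div_cancel (by positivity), one_smul]
  have h1 : (covariance B).mulVec η ⬝ᵥ (B + degreeMatrix p).mulVec η =
      η ⬝ᵥ (covariance B * (B + degreeMatrix p)).mulVec η := by
    rw [← mulVec_mulVec, dotProduct_mulVec η, ← mulVec_transpose, covariance_transpose]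
  have h2 : η ⬝ᵥ (covariance B * (B + degreeMatrix p))ᵀ.mulVec η =
      η ⬝ᵥ (covariance B * (B + degreeMatrix p)).mulVec η := by
    rw [mulVec_transpose, dotProduct_comm, ← dotProduct_mulVec]
  rw [← hB.lyapunov, add_mulVec (covariance B * (B + degreeMatrix p)), dotProduct_add, h2]
  nth_rewrite 1 [hy]
  rw [smul_dotProduct, h1, smul_eq_mul]
  ring

theorem IsDriftMatrix.trace_precision (hB : IsDriftMatrix B) (lam : ℝ) :
    (projZero p * precision B lam).trace = homDim p / (4 * lam) := by
  rw [precision, Matrix.mul_smul, trace_smul, trace_mul_comm, hB.trace_inv_covariance, smul_eq_mul]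
  ring

/-- The matrix `δ_{1/√t} M δ_{1/√t}`, where `M` is the precision matrix. -/
def precisionAt (B : Matrix (Coord p) (Coord p) ℝ) (lam t : ℝ) : Matrix (Coord p) (Coord p) ℝ :=
  Matrix.of fun c d => precision B lam c d * t⁻¹ ^ ((c.1 : ℕ) + d.1 + 1)

/-- The quadratic form in the exponent of the kernel. -/
def phase (B : Matrix (Coord p) (Coord p) ℝ) (lam : ℝ) (z : SpaceTime p) : ℝ :=
  ∑ c, ∑ d, precisionAt B lam z.2 c d * (z.1 c * z.1 d)

/-- The exponent of the kernel. -/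
def kernelLog (B : Matrix (Coord p) (Coord p) ℝ) (lam s : ℝ) (z : SpaceTime p) : ℝ :=
  -s * Real.log z.2 - phase B lam z

/-- The function `t^{-s} exp(-⟨C(t)⁻¹ x, x⟩ / (4λ))`, extended by `0` to `t ≤ 0`. -/
def kernel (B : Matrix (Coord p) (Coord p) ℝ) (lam s : ℝ) (z : SpaceTime p) : ℝ :=
  if 0 < z.2 then Real.exp (kernelLog B lam s z) else 0

theorem contDiffAt_kernelLog {lam s : ℝ} (hz : 0 < z.2) {k : WithTop ℕ∞} :
    ContDiffAt ℝ k (kernelLog B lam s) z := by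
  refine ContDiffAt.sub (contDiffAt_const.mul (contDiffAt_snd.log hz.ne')) ?_
  refine ContDiffAt.sum fun c _ => ContDiffAt.sum fun d _ => ?_
  refine ContDiffAt.mul (contDiffAt_const.mul ((contDiffAt_snd.inv hz.ne').pow _)) ?_
  have h : ∀ c : Coord p, ContDiffAt ℝ k (fun y : SpaceTime p => y.1 c) z := fun c =>
    ((EuclideanSpace.proj (𝕜 := ℝ) c).contDiff.comp contDiff_fst).contDiffAt
  exact (h c).mul (h d)

theorem dx_kernelLog {lam s : ℝ} (hz : 0 < z.2) (j : Coord p) :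
    dx j (kernelLog B lam s) z = -2 * ∑ d, precisionAt B lam z.2 j d * z.1 d := by
  refine dx_eq_of_hasDerivAt ((contDiffAt_kernelLog hz (k := 1)).differentiableAt one_ne_zero) j ?_
  have h1 : ∀ c : Coord p, HasDerivAt (fun σ : ℝ => (z + σ • spaceDir j).1 c)
      (if c = j then 1 else 0) 0 := fun c => by
    have : (fun σ : ℝ => (z + σ • spaceDir j).1 c) =
        fun σ => z.1 c + σ * (if c = j then 1 else 0) := by
      funext σ; simp [spaceDir]
    rw [this]
    simpa using ((hasDerivAt_id (0 : ℝ)).mul_const (if c = j then (1 : ℝ) else 0)).const_add (z.1 c)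
  have h2 : (fun σ : ℝ => kernelLog B lam s (z + σ • spaceDir j)) = fun σ =>
      -s * Real.log z.2 - ∑ c, ∑ d, precisionAt B lam z.2 c d *
        ((z + σ • spaceDir j).1 c * (z + σ • spaceDir j).1 d) := by
    funext σ
    have : (z + σ • spaceDir j).2 = z.2 := by simp [spaceDir]
    rw [kernelLog, phase, this]
  rw [h2]
  have h3 := (HasDerivAt.fun_sum fun c (_ : c ∈ univ) => HasDerivAt.fun_sum
    fun d (_ : d ∈ univ) => ((h1 c).mul (h1 d)).const_mul (precisionAt B lam z.2 c d)).const_sub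
      (-s * Real.log z.2)
  refine h3.congr_deriv ?_
  simp only [zero_smul, add_zero, mul_add, sum_add_distrib, ite_mul, one_mul, zero_mul, mul_ite,
    mul_one, mul_zero, sum_ite_eq', mem_univ, if_true]
  rw [sum_comm]
  simp only [sum_ite_eq', mem_univ, if_true]
  have : ∀ c, precisionAt B lam z.2 c j = precisionAt B lam z.2 j c := fun c => by
    simp only [precisionAt, of_apply, precision_symm lam c j, add_comm (c.1 : ℕ)]
  simp only [this]
  ring

theorem hess_kernelLog {lam s : ℝ} (hz : 0 < z.2) (i j : Coord p) :
    hess (kernelLog B lam s) z i j = -2 * precisionAt B lam z.2 j i := by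
  have hev : dx j (kernelLog B lam s) =ᶠ[𝓝 z]
      fun y => -2 * ∑ d, precisionAt B lam y.2 j d * y.1 d :=
    (continuous_snd.continuousAt.eventually (lt_mem_nhds hz)).mono fun y hy => dx_kernelLog hy j
  have hd := differentiableAt_dx (contDiffAt_kernelLog (B := B) (lam := lam) (s := s) hz (k := 2)) j
  change dx i (dx j (kernelLog B lam s)) z = _
  refine dx_eq_of_hasDerivAt hd i ?_
  have h1 : ∀ c : Coord p, HasDerivAt (fun σ : ℝ => (z + σ • spaceDir i).1 c)
      (if c = i then 1 else 0) 0 := fun c => by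
    have : (fun σ : ℝ => (z + σ • spaceDir i).1 c) =
        fun σ => z.1 c + σ * (if c = i then 1 else 0) := by
      funext σ; simp [spaceDir]
    rw [this]
    simpa using ((hasDerivAt_id (0 : ℝ)).mul_const (if c = i then (1 : ℝ) else 0)).const_add (z.1 c)
  have h2 : (fun σ : ℝ => dx j (kernelLog B lam s) (z + σ • spaceDir i)) = fun σ =>
      -2 * ∑ d, precisionAt B lam z.2 j d * (z + σ • spaceDir i).1 d := by
    funext σ
    have : (z + σ • spaceDir i).2 = z.2 := by simp [spaceDir]
    rw [dx_kernelLog (by rw [this]; exact hz), this]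
  rw [h2]
  have h3 := (HasDerivAt.fun_sum fun d (_ : d ∈ univ) =>
    (h1 d).const_mul (precisionAt B lam z.2 j d)).const_mul (-2)
  refine h3.congr_deriv ?_
  simp

theorem dt_kernelLog {lam s : ℝ} (hz : 0 < z.2) :
    dt (kernelLog B lam s) z = -s * z.2⁻¹ + ∑ c : Coord p, ∑ d : Coord p,
      precision B lam c d * (((c.1 : ℝ) + d.1 + 1) * z.2⁻¹ ^ ((c.1 : ℕ) + d.1 + 2)) *
        (z.1 c * z.1 d) := by
  refine dt_eq_of_hasDerivAt ((contDiffAt_kernelLog hz (k := 1)).differentiableAt one_ne_zero) ?_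
  have h1 := (Real.hasDerivAt_log hz.ne').const_mul (-s)
  have h2 : ∀ c d : Coord p, HasDerivAt (fun t : ℝ => precisionAt B lam t c d * (z.1 c * z.1 d))
      (-(precision B lam c d * (((c.1 : ℝ) + d.1 + 1) * z.2⁻¹ ^ ((c.1 : ℕ) + d.1 + 2)) *
        (z.1 c * z.1 d))) z.2 := fun c d => by
    have := ((((hasDerivAt_inv hz.ne').pow ((c.1 : ℕ) + d.1 + 1)).const_mul
      (precision B lam c d)).mul_const (z.1 c * z.1 d))
    refine this.congr_deriv ?_
    simp only [Nat.add_sub_cancel]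
    push_cast
    rw [inv_pow, inv_pow]
    field_simp
    ring
  have h3 := h1.sub (HasDerivAt.fun_sum fun c (_ : c ∈ univ) => HasDerivAt.fun_sum
    fun d (_ : d ∈ univ) => h2 c d)
  refine h3.congr_deriv ?_
  simp

/-- The kernel is a subsolution for every admissible coefficient matrix. -/
theorem IsDriftMatrix.operatorL_kernelLog_nonneg (hB : IsDriftMatrix B) {lam Lam s : ℝ}
    (hlam : 0 < lam) (hs : s = Lam * homDim p / (2 * lam)) (hA : IsElliptic lam Lam (A z))
    (hz : 0 < z.2) :
    0 ≤ grad (kernelLog B lam s) z ⬝ᵥ (A z).mulVec (grad (kernelLog B lam s) z) +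
      operatorL B A (kernelLog B lam s) z := by
  set τ := z.2⁻¹ with hτ
  have hτ0 : 0 < τ := inv_pos.2 hz
  set P := precision B lam with hP
  -- This is δ_{1/√t} x without the common factor t^{-1/2}, so that only integer powers of τ occur.
  set y : Coord p → ℝ := fun c => τ ^ (c.1 : ℕ) * z.1 c with hy
  set η := P.mulVec y with hη
  have hPx : ∀ c, ∑ d, precisionAt B lam z.2 c d * z.1 d = τ * τ ^ (c.1 : ℕ) * η c := by
    intro c
    simp only [hη, mulVec, dotProduct, mul_sum, hy]
    refine sum_congr rfl fun d _ => ?_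
    simp only [precisionAt, of_apply, ← hτ, ← hP]
    ring
  have hg : grad (kernelLog B lam s) z = fun c => -2 * (τ * τ ^ (c.1 : ℕ) * η c) := by
    funext c; rw [grad, dx_kernelLog hz, hPx]
  have h1 : lam * (4 * τ ^ 2 * (η ⬝ᵥ (projZero p).mulVec η)) ≤
      grad (kernelLog B lam s) z ⬝ᵥ (A z).mulVec (grad (kernelLog B lam s) z) := by
    refine le_of_eq_of_le ?_ (hA.lower _)
    congr 1
    rw [hg, dotProduct, dotProduct, mul_sum]
    refine sum_congr rfl fun c _ => ?_
    simp only [projZero, mulVec_diagonal]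
    split_ifs with hc
    · simp [hc]; ring
    · simp
  have h2 : (A z * hess (kernelLog B lam s) z).trace = -2 * τ * (A z * P).trace := by
    rw [trace, trace, mul_sum]
    refine sum_congr rfl fun c _ => ?_
    rw [diag_apply, diag_apply, Matrix.mul_apply, Matrix.mul_apply, mul_sum]
    refine sum_congr rfl fun d _ => ?_
    by_cases h : A z c d = 0
    · simp [h]
    · obtain ⟨h3, h4⟩ := hA.index_eq h
      rw [hess_kernelLog hz, precisionAt, of_apply, h3, h4, ← hτ, hP, precision_symm lam d c]
      simp
      ring
  -- Both P and ΛI₀ - A are nonnegative, so tr(AP) ≤ Λ tr(I₀P) = ΛQ/(4λ). This fixes s: the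
  -- resulting loss 2τ tr(AP) is at most sτ, the gain from differentiating -s log t.
  have h3 : (A z * P).trace ≤ Lam * (homDim p / (4 * lam)) := by
    have h4 : 0 ≤ (P * (Lam • projZero p - A z)).trace := by
      refine trace_mul_nonneg (hB.precision_posDef hlam).posSemidef fun v => ?_
      rw [sub_mulVec, smul_mulVec, dotProduct_sub, dotProduct_smul, smul_eq_mul]
      exact sub_nonneg.2 (hA.upper v)
    rw [Matrix.mul_sub, trace_sub, Matrix.mul_smul, trace_smul, trace_mul_comm P,
      trace_mul_comm P, hB.trace_precision, smul_eq_mul] at h4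
    linarith
  have h4 : (z.1 : Coord p → ℝ) ⬝ᵥ B.mulVec (grad (kernelLog B lam s) z) =
      -2 * τ ^ 2 * (y ⬝ᵥ B.mulVec η) := by
    rw [hg]
    simp only [dotProduct, mulVec, mul_sum, hy]
    refine sum_congr rfl fun c _ => sum_congr rfl fun d _ => ?_
    by_cases h : B c d = 0
    · simp [h]
    · rw [hB.index_eq h]; ring
  have h5 : dt (kernelLog B lam s) z =
      -s * τ + 2 * τ ^ 2 * (y ⬝ᵥ (degreeMatrix p).mulVec η) := by
    rw [dt_kernelLog hz, ← hτ]
    congr 1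
    have h6 : ∀ c d : Coord p, P c d * (((c.1 : ℝ) + d.1 + 1) * τ ^ ((c.1 : ℕ) + d.1 + 2)) *
        (z.1 c * z.1 d) = τ ^ 2 * (y c * ((c.1 : ℝ) + 1 / 2) * (P c d * y d)) +
          τ ^ 2 * (y d * ((d.1 : ℝ) + 1 / 2) * (P d c * y c)) := fun c d => by
      rw [hP, precision_symm lam d c]
      simp only [hy]
      ring
    have h7 : ∑ c, ∑ d, τ ^ 2 * (y c * ((c.1 : ℝ) + 1 / 2) * (P c d * y d)) =
        τ ^ 2 * (y ⬝ᵥ (degreeMatrix p).mulVec η) := by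
      rw [dotProduct, mul_sum]
      refine sum_congr rfl fun c _ => ?_
      rw [degreeMatrix, mulVec_diagonal, hη, mulVec, dotProduct, mul_sum, mul_sum, mul_sum]
      exact sum_congr rfl fun d _ => by ring
    rw [sum_congr rfl fun c _ => sum_congr rfl fun d _ => h6 c d]
    simp only [sum_add_distrib]
    rw [h7, sum_comm, h7]
    ring
  have h6 := hB.riccati hlam y
  rw [← hP, ← hη, add_mulVec, dotProduct_add] at h6
  rw [operatorL, h2, h4, h5]
  have h7 : 2 * τ * (A z * P).trace ≤ s * τ := by
    calc 2 * τ * (A z * P).trace ≤ 2 * τ * (Lam * (homDim p / (4 * lam))) := by gcongr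
      _ = s * τ := by rw [hs]; field_simp; ring
  -- By the Riccati equation, the drift and the time derivative of the phase cancel the lower bound
  -- `h1` for the gradient term exactly.
  have h8 : τ ^ 2 * (y ⬝ᵥ B.mulVec η + y ⬝ᵥ (degreeMatrix p).mulVec η) =
    τ ^ 2 * (2 * lam * (η ⬝ᵥ (projZero p).mulVec η)) := by rw [h6]
  linarith

theorem kernel_eventuallyEq {lam s : ℝ} (hz : 0 < z.2) :
    kernel B lam s =ᶠ[𝓝 z] fun y => Real.exp (kernelLog B lam s y) :=
  (continuous_snd.continuousAt.eventually (lt_mem_nhds hz)).mono fun _ hy => if_pos hy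

theorem contDiffAt_kernel {lam s : ℝ} (hz : 0 < z.2) {k : WithTop ℕ∞} :
    ContDiffAt ℝ k (kernel B lam s) z :=
  (contDiffAt_kernelLog hz).exp.congr_of_eventuallyEq (kernel_eventuallyEq hz)

theorem IsDriftMatrix.operatorL_kernel_nonneg (hB : IsDriftMatrix B) {lam Lam s : ℝ}
    (hlam : 0 < lam) (hs : s = Lam * homDim p / (2 * lam)) (hA : IsElliptic lam Lam (A z))
    (hz : 0 < z.2) : 0 ≤ operatorL B A (kernel B lam s) z := by
  rw [operatorL_congr (kernel_eventuallyEq hz), operatorL_exp (contDiffAt_kernelLog hz)]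
  exact mul_nonneg (Real.exp_pos _).le (hB.operatorL_kernelLog_nonneg hlam hs hA hz)

theorem kernel_nonneg (lam s : ℝ) (z : SpaceTime p) : 0 ≤ kernel B lam s z := by
  rw [kernel]; split_ifs <;> positivity

theorem kernel_of_nonpos (lam s : ℝ) (hz : z.2 ≤ 0) : kernel B lam s z = 0 :=
  if_neg hz.not_gt

/-! ### Bounds and continuity of the kernel -/

theorem exists_form_lower {ι : Type*} [Fintype ι] {X : Matrix ι ι ℝ} (hX : X.PosDef) :
    ∃ μ > 0, ∀ y : EuclideanSpace ℝ ι, μ * ‖y‖ ^ 2 ≤ (y : ι → ℝ) ⬝ᵥ X.mulVec y := by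
  have hcont : Continuous fun y : EuclideanSpace ℝ ι => (y : ι → ℝ) ⬝ᵥ X.mulVec y := by
    simp only [dotProduct, mulVec]
    fun_prop
  rcases (Metric.sphere (0 : EuclideanSpace ℝ ι) 1).eq_empty_or_nonempty with he | hne
  · refine ⟨1, one_pos, fun y => ?_⟩
    have : y = 0 := by
      by_contra hy
      have h : (‖y‖⁻¹ • y) ∈ Metric.sphere (0 : EuclideanSpace ℝ ι) 1 := by
        simp [norm_smul, hy]
      rw [he] at h
      exact h
    simp [this]
  · obtain ⟨w, hw, hmin⟩ := (isCompact_sphere (0 : EuclideanSpace ℝ ι) 1).exists_isMinOn hne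
      hcont.continuousOn
    have hpos : ∀ y : EuclideanSpace ℝ ι, y ≠ 0 → 0 < (y : ι → ℝ) ⬝ᵥ X.mulVec y := fun y hy => by
      have := hX.dotProduct_mulVec_pos (x := (y : ι → ℝ)) (by simpa using hy)
      simpa using this
    refine ⟨(w : ι → ℝ) ⬝ᵥ X.mulVec w, hpos w (ne_zero_of_mem_unit_sphere ⟨w, hw⟩), fun y => ?_⟩
    rcases eq_or_ne y 0 with rfl | hy
    · simp
    have hn : 0 < ‖y‖ := norm_pos_iff.2 hy
    have h := hmin (show (‖y‖⁻¹ • y) ∈ Metric.sphere (0 : EuclideanSpace ℝ ι) 1 by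
      simp [norm_smul, hy])
    have h2 : ((‖y‖⁻¹ • y : EuclideanSpace ℝ ι) : ι → ℝ) ⬝ᵥ
        X.mulVec (‖y‖⁻¹ • y : EuclideanSpace ℝ ι) =
        (‖y‖ ^ 2)⁻¹ * ((y : ι → ℝ) ⬝ᵥ X.mulVec y) := by
      rw [WithLp.ofLp_smul, mulVec_smul, smul_dotProduct, dotProduct_smul, smul_eq_mul, smul_eq_mul]
      ring
    have h3 : (w : ι → ℝ) ⬝ᵥ X.mulVec w ≤ (‖y‖ ^ 2)⁻¹ * ((y : ι → ℝ) ⬝ᵥ X.mulVec y) := h2 ▸ h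
    rwa [← div_eq_inv_mul, le_div_iff₀ (by positivity)] at h3

theorem IsDriftMatrix.exists_phase_lower (hB : IsDriftMatrix B) {lam : ℝ} (hlam : 0 < lam) :
    ∃ μ > 0, ∀ (x : Space p) (r : ℝ), 0 < r →
      μ * ‖dil r⁻¹ x‖ ^ 2 ≤ phase B lam (x, r ^ 2) := by
  obtain ⟨μ, hμ, h⟩ := exists_form_lower (hB.precision_posDef hlam)
  refine ⟨μ, hμ, fun x r hr => (h (dil r⁻¹ x)).trans_eq ?_⟩
  simp only [dotProduct, mulVec, phase, mul_sum, dil_apply, precisionAt, of_apply]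
  refine sum_congr rfl fun c _ => sum_congr rfl fun d _ => ?_
  rw [← inv_pow, ← pow_mul]
  ring

theorem rpow_mul_exp_neg_le {k y : ℝ} (hk : 0 < k) (hy : 0 ≤ y) :
    y ^ k * Real.exp (-y) ≤ k ^ k := by
  have h1 : y / k ≤ Real.exp (y / k) := by linarith [Real.add_one_le_exp (y / k)]
  have h2 : y ^ k ≤ k ^ k * Real.exp y := by
    calc y ^ k = (k * (y / k)) ^ k := by rw [mul_div_cancel₀ _ hk.ne']
      _ ≤ (k * Real.exp (y / k)) ^ k := by gcongr
      _ = k ^ k * Real.exp y := by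
        rw [Real.mul_rpow hk.le (Real.exp_pos _).le, ← Real.exp_mul, div_mul_cancel₀ _ hk.ne']
  calc y ^ k * Real.exp (-y) ≤ k ^ k * Real.exp y * Real.exp (-y) := by gcongr
    _ = k ^ k := by rw [mul_assoc, ← Real.exp_add]; simp

theorem kernel_eq {lam s : ℝ} (hz : 0 < z.2) :
    kernel B lam s z = z.2 ^ (-s) * Real.exp (-phase B lam z) := by
  rw [kernel, if_pos hz, kernelLog, sub_eq_add_neg, Real.exp_add, Real.rpow_def_of_pos hz]
  ring_nf

/-- For 0 < t ≤ 1 all dilation weights are at least 1, so the phase is at least μ|x|²/t, and the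
Gaussian beats any power. The power s + 1 instead of s leaves a factor t: the kernel vanishes as t
decreases to 0 away from the pole, and decays for large |x|. -/
theorem IsDriftMatrix.exists_kernel_upper (hB : IsDriftMatrix B) {lam s : ℝ} (hlam : 0 < lam)
    (hs : 0 < s) : ∃ c > 0, ∀ z : SpaceTime p, z.1 ≠ 0 → z.2 ≤ 1 →
      kernel B lam s z ≤ c * (‖z.1‖ ^ 2) ^ (-(s + 1)) * max z.2 0 := by
  obtain ⟨μ, hμ, h⟩ := hB.exists_phase_lower hlam
  refine ⟨μ ^ (-(s + 1)) * (s + 1) ^ (s + 1), by positivity, fun z hz hz1 => ?_⟩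
  rcases le_or_gt z.2 0 with hz0 | hz0
  · rw [kernel_of_nonpos _ _ hz0]
    positivity
  have hn : 0 < ‖z.1‖ := norm_pos_iff.2 hz
  obtain ⟨x, t⟩ := z
  simp only at hz0 hz1 hn ⊢
  have hr : 0 < √t := Real.sqrt_pos.2 hz0
  have h1 := h x (√t) hr
  have hr1 : 1 ≤ (√t)⁻¹ := (one_le_inv₀ hr).2 (Real.sqrt_le_one.2 hz1)
  have h2 := le_norm_dil hr1 x
  have h3 : μ * ‖x‖ ^ 2 / t ≤ phase B lam (x, t) := by
    rw [Real.sq_sqrt hz0.le] at h1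
    refine le_trans ?_ h1
    rw [mul_div_assoc]
    gcongr
    calc ‖x‖ ^ 2 / t = ((√t)⁻¹ * ‖x‖) ^ 2 := by
          rw [mul_pow, inv_pow, Real.sq_sqrt hz0.le]; ring
      _ ≤ _ := by gcongr
  rw [kernel_eq hz0, max_eq_left hz0.le]
  have h4 := rpow_mul_exp_neg_le (k := s + 1) (y := μ * ‖x‖ ^ 2 / t) (by linarith) (by positivity)
  have h5 : (μ * ‖x‖ ^ 2 / t) ^ (s + 1) = μ ^ (s + 1) * (‖x‖ ^ 2) ^ (s + 1) * t ^ (-(s + 1)) := by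
    rw [Real.div_rpow (by positivity) hz0.le, Real.mul_rpow hμ.le (by positivity),
      Real.rpow_neg hz0.le]; ring
  have h6 : t ^ (-s) = t ^ (-(s + 1)) * t := by
    nth_rewrite 3 [← Real.rpow_one t]
    rw [← Real.rpow_add hz0]; congr 1; ring
  calc t ^ (-s) * Real.exp (-phase B lam (x, t))
      ≤ t ^ (-s) * Real.exp (-(μ * ‖x‖ ^ 2 / t)) := by gcongr
    _ = (μ ^ (-(s + 1)) * (‖x‖ ^ 2) ^ (-(s + 1))) *
        ((μ * ‖x‖ ^ 2 / t) ^ (s + 1) * Real.exp (-(μ * ‖x‖ ^ 2 / t))) * t := by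
      rw [h5, h6, Real.rpow_neg hμ.le, Real.rpow_neg (by positivity : (0 : ℝ) ≤ ‖x‖ ^ 2)]
      have : μ ^ (s + 1) ≠ 0 := by positivity
      have : (‖x‖ ^ 2) ^ (s + 1) ≠ 0 := by positivity
      field_simp
    _ ≤ (μ ^ (-(s + 1)) * (‖x‖ ^ 2) ^ (-(s + 1))) * (s + 1) ^ (s + 1) * t := by gcongr
    _ = _ := by ring

theorem IsDriftMatrix.continuousAt_kernel (hB : IsDriftMatrix B) {lam s : ℝ} (hlam : 0 < lam)
    (hs : 0 < s) (hz : z ≠ 0) : ContinuousAt (kernel B lam s) z := by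
  rcases lt_trichotomy z.2 0 with h | h | h
  · have : kernel B lam s =ᶠ[𝓝 z] fun _ => 0 :=
      (continuous_snd.continuousAt.eventually (gt_mem_nhds h)).mono
        fun y hy => kernel_of_nonpos _ _ (le_of_lt hy)
    exact continuousAt_const.congr this.symm
  · have hx : z.1 ≠ 0 := fun hx => hz (Prod.ext hx h)
    obtain ⟨c, hc, hbd⟩ := hB.exists_kernel_upper hlam hs
    rw [ContinuousAt, kernel_of_nonpos _ _ h.le]
    have h1 : Tendsto (fun y : SpaceTime p => c * (‖y.1‖ ^ 2) ^ (-(s + 1)) * max y.2 0) (𝓝 z)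
        (𝓝 0) := by
      have h2 : ContinuousAt (fun y : SpaceTime p => c * (‖y.1‖ ^ 2) ^ (-(s + 1)) * max y.2 0) z := by
        refine (continuousAt_const.mul (ContinuousAt.rpow_const (by fun_prop) (Or.inl ?_))).mul
          (by fun_prop)
        simpa using hx
      have h3 := h2.tendsto
      simpa [h] using h3
    refine squeeze_zero' (.of_forall fun y => kernel_nonneg _ _ _) ?_ h1
    filter_upwards [continuous_fst.continuousAt.eventually_ne hx,
      continuous_snd.continuousAt.eventually (gt_mem_nhds (show z.2 < 1 by rw [h]; exact one_pos))]
      with y hy1 hy2 using hbd y hy1 (le_of_lt hy2)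
  · exact (contDiffAt_kernel h (k := 0)).continuousAt

theorem exists_kernel_lower (lam s : ℝ) {K : Set (SpaceTime p)} (hK : IsCompact K)
    (hpos : ∀ z ∈ K, 0 < z.2) : ∃ c > 0, ∀ z ∈ K, c ≤ kernel B lam s z := by
  rcases K.eq_empty_or_nonempty with rfl | hne
  · exact ⟨1, one_pos, by simp⟩
  obtain ⟨w, hw, hmin⟩ := hK.exists_isMinOn hne (f := kernel B lam s) fun z hz =>
    (contDiffAt_kernel (hpos z hz) (k := 0)).continuousAt.continuousWithinAt
  refine ⟨_, ?_, hmin⟩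
  rw [kernel, if_pos (hpos w hw)]
  exact Real.exp_pos _

theorem IsDriftMatrix.exists_kernel_small (hB : IsDriftMatrix B) {lam s : ℝ} (hlam : 0 < lam)
    (hs : 0 < s) {ε : ℝ} (hε : 0 < ε) :
    ∃ R > 0, ∀ z : SpaceTime p, R ≤ ‖z.1‖ → z.2 ≤ 1 → kernel B lam s z ≤ ε := by
  obtain ⟨c, hc, hbd⟩ := hB.exists_kernel_upper hlam hs
  have h1 : Tendsto (fun R : ℝ => c * (R ^ 2) ^ (-(s + 1))) atTop (𝓝 (c * 0)) :=
    ((tendsto_rpow_neg_atTop (by linarith : 0 < s + 1)).comp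
      (tendsto_pow_atTop two_ne_zero)).const_mul c
  rw [mul_zero] at h1
  obtain ⟨R, hR, hR0⟩ := ((h1.eventually (gt_mem_nhds hε)).and (eventually_gt_atTop 0)).exists
  refine ⟨R, hR0, fun z hz hz1 => ?_⟩
  have hz0 : 0 < ‖z.1‖ := hR0.trans_le hz
  refine (hbd z (norm_pos_iff.1 hz0) hz1).trans ?_
  calc c * (‖z.1‖ ^ 2) ^ (-(s + 1)) * max z.2 0 ≤ c * (‖z.1‖ ^ 2) ^ (-(s + 1)) * 1 := by
        gcongr
        exact max_le hz1 zero_le_one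
    _ ≤ c * (R ^ 2) ^ (-(s + 1)) := by
        rw [mul_one]
        gcongr c * ?_
        exact Real.rpow_le_rpow_of_nonpos (by positivity) (by gcongr) (by linarith)
    _ ≤ ε := hR.le

theorem measurable_kernel (lam s : ℝ) : Measurable (kernel B lam s) := by
  refine Measurable.ite (measurableSet_lt measurable_const measurable_snd) ?_ measurable_const
  unfold kernelLog phase precisionAt
  simp only [of_apply]
  fun_prop

/-! ### Potentials and their discretization -/

theorem lintegral_comp_dil {r : ℝ} (hr : 0 < r) {f : Space p → ENNReal} (hf : Measurable f) :
    ∫⁻ x, f (dil r x) = ENNReal.ofReal (r ^ homDim p)⁻¹ * ∫⁻ x, f x := by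
  have h : Measure.map (dil r) volume = ENNReal.ofReal (r ^ homDim p)⁻¹ •
      (volume : Measure (Space p)) := by
    ext S hS
    rw [Measure.map_apply (dil r).continuous.measurable hS, volume_preimage_dil hr]
    rfl
  rw [← lintegral_map hf (dil r).continuous.measurable, h, lintegral_smul_measure, smul_eq_mul]

/-- At time lag σ the integral over the poles is at most σ^{-s} · σ^{Q/2} times a Gaussian integral,
by a translation and the dilation δ_{√σ}. The hypothesis on s makes the exponent Q/2 - s larger than
-1, so the integral over 0 < σ ≤ 1 converges. -/
theorem IsDriftMatrix.exists_potential_le (hB : IsDriftMatrix B) {lam s : ℝ} (hlam : 0 < lam)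
    (hs : s < homDim p / 2 + 1) : ∃ S > 0, ∀ z : SpaceTime p,
      ∫⁻ ζ in Set.univ ×ˢ Set.Ici (z.2 - 1), ENNReal.ofReal (kernel B lam s (chartInv B ζ 1 z)) ≤
        ENNReal.ofReal S := by
  obtain ⟨μ, hμ, hph⟩ := hB.exists_phase_lower hlam
  set κ : ℝ := (‖E B (-1)‖ + 1)⁻¹ with hκ
  have hκ0 : 0 < κ := by positivity
  have hE1 : ∀ v : Space p, κ * ‖v‖ ≤ ‖E B 1 v‖ := fun v => by
    have h1 : ‖v‖ ≤ ‖E B (-1)‖ * ‖E B 1 v‖ := by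
      nth_rewrite 1 [← E_neg_apply (B := B) 1 v]
      exact (E B (-1)).le_opNorm _
    rw [hκ, inv_mul_le_iff₀ (by positivity)]
    nlinarith [norm_nonneg (E B 1 v)]
  set g : Space p → ENNReal := fun y => ENNReal.ofReal (Real.exp (-(μ * κ ^ 2) * ‖y‖ ^ 2)) with hg
  have hgm : Measurable g := by fun_prop
  have hI : ∫⁻ y, g y < ⊤ := by
    have h1 := GaussianFourier.integrable_cexp_neg_mul_sq_norm_add (V := Space p)
      (b := ((μ * κ ^ 2 : ℝ) : ℂ)) 
      (by rw [Complex.ofReal_re]; positivity) 0 0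
    refine lt_of_le_of_lt (lintegral_mono fun y => ?_) h1.2
    rw [hg, ← ofReal_norm]
    refine ENNReal.ofReal_le_ofReal (le_of_eq ?_)
    rw [Complex.norm_exp]
    congr 1
    simp [← Complex.ofReal_pow]
  have hinner : ∀ (z : SpaceTime p) (τ : ℝ), z.2 - 1 ≤ τ →
      ∫⁻ ξ, ENNReal.ofReal (kernel B lam s (chartInv B (ξ, τ) 1 z)) ≤
      (Set.Ioc (0 : ℝ) 1).indicator
        (fun σ => ENNReal.ofReal (σ ^ (homDim p / 2 - s : ℝ)) * ∫⁻ y, g y) (z.2 - τ) := by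
    intro z τ hτ
    have hch : ∀ ξ : Space p, chartInv B (ξ, τ) 1 z = (z.1 - E B (z.2 - τ) ξ, z.2 - τ) := fun ξ => by
      simp [chartInv, dil_one]
    rcases le_or_gt (z.2 - τ) 0 with h0 | h0
    · have : ∀ ξ : Space p, kernel B lam s (chartInv B (ξ, τ) 1 z) = 0 := fun ξ => by
        rw [hch]; exact kernel_of_nonpos _ _ h0
      simp [this]
    set σ := z.2 - τ with hσ
    rw [Set.indicator_of_mem (show σ ∈ Set.Ioc (0 : ℝ) 1 from ⟨h0, by linarith⟩)]
    have hr : 0 < √σ := Real.sqrt_pos.2 h0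
    have hsq : √σ ^ 2 = σ := Real.sq_sqrt h0.le
    set x' := E B (-σ) z.1 with hx'
    have hle : ∀ ξ : Space p, ENNReal.ofReal (kernel B lam s (chartInv B (ξ, τ) 1 z)) ≤
        ENNReal.ofReal (σ ^ (-s)) * g (dil (√σ)⁻¹ (ξ - x')) := by
      intro ξ
      rw [hch, hg, ← ENNReal.ofReal_mul (by positivity)]
      refine ENNReal.ofReal_le_ofReal ?_
      rw [kernel_eq h0]
      gcongr
      have h1 := hph (z.1 - E B σ ξ) (√σ) hr
      rw [hsq] at h1
      -- Since δ_{1/√σ}E(σ) = E(1)δ_{1/√σ}, the dependence on σ is moved to the fixed operator E(1),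
      -- which is bounded below by κ.
      have h2 : dil (√σ)⁻¹ (z.1 - E B σ ξ) = -E B 1 (dil (√σ)⁻¹ (ξ - x')) := by
        have h3 := hB.E_dil (√σ)⁻¹ σ (ξ - x')
        rw [inv_pow, hsq, inv_mul_cancel₀ h0.ne'] at h3
        rw [h3, map_sub (E B σ), hx', E_apply_neg, ← map_neg, neg_sub]
      rw [h2, norm_neg] at h1
      have h4 : (κ * ‖dil (√σ)⁻¹ (ξ - x')‖) ^ 2 ≤ ‖E B 1 (dil (√σ)⁻¹ (ξ - x'))‖ ^ 2 := by
        gcongr; exact hE1 _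
      have h5 := mul_le_mul_of_nonneg_left h4 hμ.le
      rw [mul_pow] at h5
      linarith
    refine (lintegral_mono hle).trans_eq ?_
    rw [lintegral_const_mul _ (by fun_prop),
      lintegral_sub_right_eq_self (fun ξ => g (dil (√σ)⁻¹ ξ)) x',
      lintegral_comp_dil (inv_pos.2 hr) hgm, ← mul_assoc, ← ENNReal.ofReal_mul (by positivity)]
    congr 2
    rw [inv_pow, inv_inv, sub_eq_neg_add, Real.rpow_add h0]
    congr 1
    rw [← Real.rpow_natCast, Real.sqrt_eq_rpow, ← Real.rpow_mul h0.le]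
    congr 1
    ring
  set h : ℝ → ENNReal := (Set.Ioc (0 : ℝ) 1).indicator
        (fun σ => ENNReal.ofReal (σ ^ (homDim p / 2 - s : ℝ)) * ∫⁻ y, g y) with hh
  have hJ : ∫⁻ σ, h σ < ⊤ := by
    rw [hh, lintegral_indicator measurableSet_Ioc, lintegral_mul_const _ (by fun_prop)]
    refine ENNReal.mul_lt_top ?_ hI
    have h1 := (intervalIntegral.intervalIntegrable_rpow' (a := 0) (b := 1)
      (r := (homDim p / 2 - s : ℝ)) (by linarith)).1
    refine lt_of_le_of_lt (lintegral_mono fun σ => ?_) h1.2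
    exact Real.ofReal_le_enorm _
  refine ⟨(∫⁻ σ, h σ).toReal + 1, by positivity, fun z => ?_⟩
  have hmeas : Measurable fun ζ : SpaceTime p =>
      ENNReal.ofReal (kernel B lam s (chartInv B ζ 1 z)) :=
    ((measurable_kernel lam s).comp (continuous_chartInv_uncurry.comp
      (by fun_prop : Continuous fun ζ : SpaceTime p => (z, ζ))).measurable).ennreal_ofReal
  rw [Measure.volume_eq_prod, ← Measure.prod_restrict, Measure.restrict_univ,
    lintegral_prod_symm _ hmeas.aemeasurable]
  calc _ ≤ ∫⁻ τ in Set.Ici (z.2 - 1), h (z.2 - τ) :=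
        setLIntegral_mono' measurableSet_Ici fun τ hτ => hinner z τ hτ
    _ ≤ ∫⁻ τ, h (z.2 - τ) := setLIntegral_le_lintegral _ _
    _ = ∫⁻ σ, h σ := lintegral_sub_left_eq_self h z.2
    _ = ENNReal.ofReal (∫⁻ σ, h σ).toReal := (ENNReal.ofReal_toReal hJ.ne).symm
    _ ≤ _ := ENNReal.ofReal_le_ofReal (by linarith)

/-- Uniform approximation from above of a potential with continuous kernel by finite sums. -/
theorem exists_finite_sum_le_lintegral {X Y : Type*} [PseudoMetricSpace X] [PseudoMetricSpace Y]
    [MeasurableSpace Y] [OpensMeasurableSpace Y] {μ : Measure Y} {K : Set X} {H : Set Y}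
    (hK : IsCompact K) (hH : IsCompact H) (hHm : MeasurableSet H) (hμ : μ H ≠ ⊤) {f : X × Y → ℝ}
    (hf : ContinuousOn f (K ×ˢ H)) (hf0 : ∀ q, 0 ≤ f q) {ε : ℝ} (hε : 0 < ε) :
    ∃ (N : ℕ) (c : Fin N → Y) (m : Fin N → ℝ), (∀ i, c i ∈ H) ∧ (∀ i, 0 ≤ m i) ∧
      ∑ i, m i = (μ H).toReal ∧ ∀ x ∈ K, ENNReal.ofReal (∑ i, m i * f (x, c i)) ≤
        ∫⁻ y in H, ENNReal.ofReal (f (x, y)) ∂μ + ENNReal.ofReal ε * μ H := by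
  obtain ⟨δ, hδ, hfδ⟩ := Metric.uniformContinuousOn_iff.1
    ((hK.prod hH).uniformContinuousOn_of_continuous hf) ε hε
  obtain ⟨t, htH, htf, htc⟩ := hH.finite_cover_balls hδ
  set e := htf.toFinset.equivFin.symm
  set c : Fin htf.toFinset.card → Y := fun i => (e i : Y) with hc
  have hcH : ∀ i, c i ∈ H := fun i => htH (htf.mem_toFinset.1 (e i).2)
  set S : Fin htf.toFinset.card → Set Y := fun i => H ∩ Metric.ball (c i) δ with hS
  have hSm : ∀ i, MeasurableSet (S i) := fun i => hHm.inter Metric.isOpen_ball.measurableSet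
  -- H is partitioned into pieces of radius δ around the chosen poles; each weight is the measure of
  -- its piece, and uniform continuity costs ε per unit of measure.
  set D := disjointed S with hD
  have hDm : ∀ i, MeasurableSet (D i) := fun i => by
    rw [hD, disjointed_apply, sup_set_eq_biUnion]
    exact (hSm i).diff (Finset.measurableSet_biUnion _ fun j _ => hSm j)
  have hDd : Pairwise (Function.onFun Disjoint D) := disjoint_disjointed S
  have hU : ⋃ i, D i = H := by
    rw [hD, iUnion_disjointed]
    refine Set.Subset.antisymm (Set.iUnion_subset fun i => Set.inter_subset_left) fun y hy => ?_
    obtain ⟨w, hw, hyw⟩ := Set.mem_iUnion₂.1 (htc hy)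
    refine Set.mem_iUnion.2 ⟨e.symm ⟨w, htf.mem_toFinset.2 hw⟩, hy, ?_⟩
    simpa [hc] using hyw
  have hDfin : ∀ i, μ (D i) ≠ ⊤ := fun i =>
    ne_top_of_le_ne_top hμ (measure_mono (hU ▸ Set.subset_iUnion D i))
  refine ⟨_, c, fun i => (μ (D i)).toReal, hcH, fun i => ENNReal.toReal_nonneg, ?_, fun x hx => ?_⟩
  · rw [← ENNReal.toReal_sum fun i _ => hDfin i, ← hU, measure_iUnion hDd hDm, tsum_fintype]
  · rw [ENNReal.ofReal_sum_of_nonneg fun i _ => mul_nonneg ENNReal.toReal_nonneg (hf0 _)]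
    calc ∑ i, ENNReal.ofReal ((μ (D i)).toReal * f (x, c i))
        ≤ ∑ i, ∫⁻ y in D i, (ENNReal.ofReal (f (x, y)) + ENNReal.ofReal ε) ∂μ := by
          refine sum_le_sum fun i _ => ?_
          rw [ENNReal.ofReal_mul ENNReal.toReal_nonneg, ENNReal.ofReal_toReal (hDfin i), mul_comm,
            ← setLIntegral_const]
          refine setLIntegral_mono' (hDm i) fun y hy => ?_
          have hyS : y ∈ S i := disjointed_subset S i hy
          rw [← ENNReal.ofReal_add (hf0 _) hε.le]
          refine ENNReal.ofReal_le_ofReal ?_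
          have h1 := hfδ (x, c i) ⟨hx, hcH i⟩ (x, y) ⟨hx, hyS.1⟩ (by
            rw [Prod.dist_eq, dist_self, dist_comm]
            exact max_lt hδ hyS.2)
          rw [Real.dist_eq] at h1
          linarith [(abs_lt.1 h1).2]
      _ = ∫⁻ y in H, (ENNReal.ofReal (f (x, y)) + ENNReal.ofReal ε) ∂μ := by
          rw [← hU, lintegral_iUnion hDm hDd, tsum_fintype]
      _ = _ := by
          rw [lintegral_add_right _ measurable_const, setLIntegral_const]

/-! ### Translated kernels and the comparison argument -/

theorem contDiffAt_kernel_chartInv {lam s : ℝ} {ζ : SpaceTime p} (h : ζ.2 < z.2) :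
    ContDiffAt ℝ 2 (fun y => kernel B lam s (chartInv B ζ 1 y)) z := by
  have h1 : 0 < (chartInv B ζ 1 z).2 := by simpa [chartInv] using h
  have h2 : ContDiff ℝ 2 (chartInv B ζ 1) := by rw [chartInv_one]; exact contDiff_chart _ _
  exact (contDiffAt_kernel h1).comp z h2.contDiffAt

/-- The inverse of a left translation is again a left translation, so invariance applies. The
coefficients are frozen at the value A(z), which suffices because the subsolution property is
pointwise and uniform in A. -/
theorem IsDriftMatrix.operatorL_kernel_chartInv_nonneg (hB : IsDriftMatrix B) {lam Lam s : ℝ}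
    (hlam : 0 < lam) (hs : s = Lam * homDim p / (2 * lam)) (hA : IsElliptic lam Lam (A z))
    {ζ : SpaceTime p} (h : ζ.2 < z.2) :
    0 ≤ operatorL B A (fun y => kernel B lam s (chartInv B ζ 1 y)) z := by
  have h1 : 0 < (chartInv B ζ 1 z).2 := by simpa [chartInv] using h
  have h2 : (fun y => kernel B lam s (chartInv B ζ 1 y)) =
      kernel B lam s ∘ chart B (-(E B (-ζ.2) ζ.1), -ζ.2) 1 := by rw [← chartInv_one]; rfl
  rw [chartInv_one] at h1
  rw [h2, hB.operatorL_comp_chart (A := fun _ => A z) rfl hA.block_eq_zero (contDiffAt_kernel h1)]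
  exact mul_nonneg (by positivity) (hB.operatorL_kernel_nonneg hlam hs hA h1)

theorem kernel_chartInv_of_le (lam s : ℝ) {ζ : SpaceTime p} (h : z.2 ≤ ζ.2) :
    kernel B lam s (chartInv B ζ 1 z) = 0 :=
  kernel_of_nonpos _ _ (by simpa [chartInv] using h)

theorem IsDriftMatrix.continuousAt_kernel_chartInv (hB : IsDriftMatrix B) {lam s : ℝ}
    (hlam : 0 < lam) (hs : 0 < s) {q : SpaceTime p × SpaceTime p} (hq : q.1 ≠ q.2) :
    ContinuousAt (fun q : SpaceTime p × SpaceTime p => kernel B lam s (chartInv B q.2 1 q.1)) q := by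
  have h1 : chartInv B q.2 1 q.1 ≠ 0 := fun h0 => hq (by
    have h2 := chart_chartInv (B := B) q.2 one_ne_zero q.1
    rw [h0, chart_apply] at h2
    rw [← h2]
    ext1 <;> simp [E_zero])
  exact ContinuousAt.comp (f := fun q : SpaceTime p × SpaceTime p => chartInv B q.2 1 q.1)
    (hB.continuousAt_kernel hlam hs h1) continuous_chartInv_uncurry.continuousAt

/-- Comparison of a nonnegative supersolution with a finite sum of kernels whose poles lie in
`{u > κ}`. -/
theorem IsDriftMatrix.comparison (hB : IsDriftMatrix B) {lam Lam s : ℝ} (hlam : 0 < lam)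
    (hs : s = Lam * homDim p / (2 * lam)) (hs0 : 0 < s) {Ω : Set (SpaceTime p)} (hΩ : IsOpen Ω)
    (hA : ∀ z ∈ Ω, IsElliptic lam Lam (A z)) (hu : ContDiffOn ℝ 2 u Ω) {K b t₁ : ℝ}
    (ht₁ : t₁ < 0) (hsub : Metric.closedBall (0 : Space p) K ×ˢ Set.Icc (-b) 0 ⊆ Ω)
    (hu0 : ∀ z ∈ Metric.closedBall (0 : Space p) K ×ˢ Set.Icc (-b) 0, 0 ≤ u z)
    (hLu : ∀ z ∈ Metric.ball (0 : Space p) K ×ˢ Set.Ioo (-b) 0, operatorL B A u z ≤ 0)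
    {ι : Type*} [Fintype ι] {ζ : ι → SpaceTime p} {m : ι → ℝ} (hm : ∀ i, 0 ≤ m i)
    {κ S β : ℝ} (hκ : 0 < κ) (hS : 0 < S) (hβ : 0 ≤ β) (hζ : ∀ i, κ < u (ζ i))
    (hζb : ∀ i, -b < (ζ i).2)
    (hFS : ∀ z ∈ Metric.closedBall (0 : Space p) K ×ˢ Set.Icc (-b) t₁, u z ≤ κ →
      ∑ i, m i * kernel B lam s (chartInv B (ζ i) 1 z) ≤ S)
    (hFβ : ∀ z ∈ Metric.closedBall (0 : Space p) K ×ˢ Set.Icc (-b) t₁, ‖z.1‖ = K →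
      ∑ i, m i * kernel B lam s (chartInv B (ζ i) 1 z) ≤ β) :
    ∀ z ∈ Metric.closedBall (0 : Space p) K ×ˢ Set.Icc (-b) t₁, u z ≤ κ →
      κ * (∑ i, m i * kernel B lam s (chartInv B (ζ i) 1 z) - β) ≤ S * u z := by
  set F : SpaceTime p → ℝ := fun z => ∑ i, m i * kernel B lam s (chartInv B (ζ i) 1 z) with hF
  set Z : Set (SpaceTime p) := Metric.closedBall (0 : Space p) K ×ˢ Set.Icc (-b) t₁ with hZ
  have hZsub : Z ⊆ Metric.closedBall (0 : Space p) K ×ˢ Set.Icc (-b) 0 :=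
    Set.prod_mono_right (Set.Icc_subset_Icc_right ht₁.le)
  have hZc : IsCompact Z := (isCompact_closedBall _ _).prod isCompact_Icc
  have huc : ContinuousOn u Z := hu.continuousOn.mono (hZsub.trans hsub)
  -- Restricting to {u ≤ κ} excludes the poles, so F is continuous there; on the new boundary part u
  -- = κ the bound F ≤ S gives the sign.
  set Z' : Set (SpaceTime p) := {z ∈ Z | u z ≤ κ} with hZ'
  have hZ'c : IsCompact Z' := by
    have : IsClosed Z' := huc.preimage_isClosed_of_isClosed hZc.isClosed isClosed_Iic
    exact hZc.of_isClosed_subset this fun z hz => hz.1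
  have hFc : ContinuousOn F Z' := by
    refine continuousOn_finsetSum _ fun i _ => continuousOn_const.mul fun z hz => ?_
    have hne : z ≠ ζ i := fun h => (hζ i).not_ge (h ▸ hz.2)
    exact (ContinuousAt.comp (f := fun z : SpaceTime p => (z, ζ i))
      (hB.continuousAt_kernel_chartInv hlam hs0 (q := (z, ζ i)) hne)
      (by fun_prop)).continuousWithinAt
  intro z₁ hz₁ hz₁κ
  refine le_of_forall_pos_le_add fun ε' hε' => ?_
  have hb1 : 0 ≤ z₁.2 + b := by linarith [hz₁.2.1]
  set ε : ℝ := ε' / (z₁.2 + b + 1) with hε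
  have hε0 : 0 < ε := by positivity
  have hεle : ε * (z₁.2 + b) ≤ ε' := by
    rw [hε, div_mul_eq_mul_div, div_le_iff₀ (by positivity)]; nlinarith
  -- The term ε(t + b) makes the supersolution strict, since the operator sends t to -1; ε was
  -- chosen so that this costs at most ε' at z₁.
  set w : SpaceTime p → ℝ := fun z => S * u z - κ * (F z - β) + ε * (z.2 + b) with hw
  have hwc : ContinuousOn w Z' := by
    refine ContinuousOn.add (ContinuousOn.sub (continuousOn_const.mul (huc.mono fun z hz => hz.1))
      (continuousOn_const.mul (hFc.sub continuousOn_const))) (by fun_prop)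
  obtain ⟨y, hy, hmin⟩ := hZ'c.exists_isMinOn ⟨z₁, hz₁, hz₁κ⟩ hwc
  suffices hwy : 0 ≤ w y by
    have h1 : w y ≤ w z₁ := hmin (show z₁ ∈ Z' from ⟨hz₁, hz₁κ⟩)
    -- With w ≥ 0 at the minimum, the claim at z₁ holds up to ε'. A negative minimum is excluded
    -- below on u = κ, on the lateral side and at the bottom, where no pole has yet acted.
    simp only [hw] at h1 hwy
    linarith
  by_contra! hneg
  have huy0 : 0 ≤ u y := hu0 y (hZsub hy.1)
  have hyb : 0 ≤ ε * (y.2 + b) := mul_nonneg hε0.le (by linarith [hy.1.2.1])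
  have hyκ : u y < κ := by
    refine hy.2.lt_of_ne fun h => hneg.not_ge ?_
    have h1 := hFS y hy.1 hy.2
    simp only [hw, h]
    nlinarith
  have hyK : ‖y.1‖ < K := by
    refine (mem_closedBall_zero_iff.1 hy.1.1).lt_of_ne fun h => hneg.not_ge ?_
    have h1 := hFβ y hy.1 h
    simp only [hw]
    have h2 : κ * (F y - β) ≤ 0 := mul_nonpos_of_nonneg_of_nonpos hκ.le (by simpa [hF] using h1)
    have h3 : 0 ≤ S * u y := by positivity
    linarith
  have hyt : -b < y.2 := by
    refine hy.1.2.1.lt_of_ne fun h => hneg.not_ge ?_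
    have h1 : F y = 0 := sum_eq_zero fun i _ => by
      rw [kernel_chartInv_of_le _ _ (by rw [← h]; exact (hζb i).le), mul_zero]
    simp only [hw, h1]
    have h3 : 0 ≤ S * u y := by positivity
    nlinarith
  have hyΩ : y ∈ Ω := hsub (hZsub hy.1)
  have huy : ContDiffAt ℝ 2 u y := hu.contDiffAt (hΩ.mem_nhds hyΩ)
  classical
  -- Kernels with poles at the time of y or later need not be differentiable at y, but they vanish
  -- up to that time. Dropping them leaves F unchanged in the past of y, which is all the minimum
  -- principle sees.
  set I : Finset ι := univ.filter fun i => (ζ i).2 < y.2 with hI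
  set F' : SpaceTime p → ℝ := fun z => ∑ i ∈ I, m i * kernel B lam s (chartInv B (ζ i) 1 z) with hF'
  have hFF' : ∀ z : SpaceTime p, z.2 ≤ y.2 → F z = F' z := by
    intro z hz
    refine (sum_subset (filter_subset _ _) fun i _ hi => ?_).symm
    have : y.2 ≤ (ζ i).2 := by simpa [hI] using hi
    rw [kernel_chartInv_of_le _ _ (hz.trans this), mul_zero]
  have hI' : ∀ i ∈ I, (ζ i).2 < y.2 := fun i hi => (mem_filter.1 hi).2
  have hF'd : ContDiffAt ℝ 2 F' y :=
    ContDiffAt.sum fun i hi => contDiffAt_const.mul (contDiffAt_kernel_chartInv (hI' i hi))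
  have hLF' : 0 ≤ operatorL B A F' y := by
    rw [hF', operatorL_sum I _ fun i hi =>
      contDiffAt_const.mul (contDiffAt_kernel_chartInv (hI' i hi))]
    refine sum_nonneg fun i hi => ?_
    rw [operatorL_const_mul _ (contDiffAt_kernel_chartInv (hI' i hi))]
    exact mul_nonneg (hm i)
      (hB.operatorL_kernel_chartInv_nonneg hlam hs (hA y hyΩ) (hI' i hi))
  set v : SpaceTime p → ℝ := (fun z => S * u z) + ((fun z => -κ * F' z) + fun z => ε * z.2) with hv
  have hvw : ∀ z : SpaceTime p, z.2 ≤ y.2 → v z = w z - κ * β - ε * b := by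
    intro z hz
    simp only [hv, hw, Pi.add_apply, hFF' z hz]
    ring
  have hd1 : ContDiffAt ℝ 2 (fun z => S * u z) y := contDiffAt_const.mul huy
  have hd2 : ContDiffAt ℝ 2 (fun z => -κ * F' z) y := contDiffAt_const.mul hF'd
  have hd3 : ContDiffAt ℝ 2 (fun z : SpaceTime p => ε * z.2) y :=
    contDiffAt_const.mul contDiffAt_snd
  have hd23 : ContDiffAt ℝ 2 ((fun z => -κ * F' z) + fun z : SpaceTime p => ε * z.2) y :=
    hd2.add hd3
  have hLv := operatorL_nonneg_of_min (B := B) (u := v) (hA y hyΩ).posSemidef (hd1.add hd23) (by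
    have e1 : ∀ᶠ z : SpaceTime p in 𝓝 y, ‖z.1‖ < K :=
      (by fun_prop : Continuous fun z : SpaceTime p => ‖z.1‖).continuousAt.eventually
        (gt_mem_nhds hyK)
    have e2 : ∀ᶠ z : SpaceTime p in 𝓝 y, -b < z.2 :=
      continuous_snd.continuousAt.eventually (lt_mem_nhds hyt)
    have e3 : ∀ᶠ z : SpaceTime p in 𝓝 y, u z < κ := huy.continuousAt.eventually (gt_mem_nhds hyκ)
    filter_upwards [e1, e2, e3] with z h1 h2 h3 hz
    have hzZ : z ∈ Z' :=
      ⟨⟨mem_closedBall_zero_iff.2 h1.le, h2.le, hz.trans hy.1.2.2⟩, h3.le⟩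
    change v y ≤ v z
    rw [hvw y le_rfl, hvw z hz]
    linarith [show w y ≤ w z from hmin hzZ])
  rw [hv, operatorL_add hd1 hd23, operatorL_add hd2 hd3, operatorL_const_mul _ huy,
    operatorL_const_mul _ hF'd, operatorL_const_mul _ contDiffAt_snd, operatorL_time] at hLv
  -- Since y.2 ≤ t₁ < 0, the inequality for u also holds at the top of the truncated cylinder.
  have hLuy := hLu y ⟨mem_ball_zero_iff.2 hyK, hyt, hy.1.2.2.trans_lt ht₁⟩
  nlinarith [mul_nonneg hκ.le hLF', mul_nonneg hS.le (neg_nonneg.2 hLuy)]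

/-! ### The weak L¹ estimate -/

/-- The closed cylinder `{‖x‖ ≤ K, -b ≤ t ≤ 0}`. -/
def box (p : Fin (n + 1) → ℕ) (K b : ℝ) : Set (SpaceTime p) :=
  Metric.closedBall (0 : Space p) K ×ˢ Set.Icc (-b) 0

/-- The closed cylinder `{‖x‖ ≤ R, -7b/8 ≤ t ≤ -b/2}`. -/
def lowerBox (p : Fin (n + 1) → ℕ) (R b : ℝ) : Set (SpaceTime p) :=
  Metric.closedBall (0 : Space p) R ×ˢ Set.Icc (-(7 * b / 8)) (-(b / 2))

/-- The closed cylinder `{‖x‖ ≤ R, -b/4 ≤ t ≤ 0}`. -/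
def upperBox (p : Fin (n + 1) → ℕ) (R b : ℝ) : Set (SpaceTime p) :=
  Metric.closedBall (0 : Space p) R ×ˢ Set.Icc (-(b / 4)) 0

theorem isCompact_lowerBox (R b : ℝ) : IsCompact (lowerBox p R b) :=
  (isCompact_closedBall _ _).prod isCompact_Icc

theorem isCompact_upperBox (R b : ℝ) : IsCompact (upperBox p R b) :=
  (isCompact_closedBall _ _).prod isCompact_Icc

/-- The weak `L¹` estimate with constant `c`: the measure of the part of the lower cylinder where a
nonnegative supersolution is at least `ℓ` bounds the supersolution from below in the upper one. -/
def WeakEstimate (B : Matrix (Coord p) (Coord p) ℝ) (lam Lam b R K c : ℝ) : Prop :=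
  ∀ (Ω : Set (SpaceTime p)) (A : SpaceTime p → Matrix (Coord p) (Coord p) ℝ)
    (u : SpaceTime p → ℝ), IsOpen Ω → (∀ z ∈ Ω, IsElliptic lam Lam (A z)) → ContDiffOn ℝ 2 u Ω →
    box p K b ⊆ Ω → (∀ z ∈ box p K b, 0 ≤ u z) →
    (∀ z ∈ Metric.ball (0 : Space p) K ×ˢ Set.Ioo (-b) 0, operatorL B A u z ≤ 0) →
    ∀ H ⊆ lowerBox p R b, IsCompact H → ∀ ℓ > 0, (∀ z ∈ H, ℓ ≤ u z) →
    ∀ z ∈ upperBox p R b, c * ℓ * (volume H).toReal ≤ u z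

theorem exists_norm_E_le (B : Matrix (Coord p) (Coord p) ℝ) :
    ∃ L > 0, ∀ σ : ℝ, |σ| ≤ 1 → ‖E B σ‖ ≤ L := by
  obtain ⟨L, hL⟩ := (isCompact_Icc (a := (-1 : ℝ)) (b := 1)).exists_bound_of_continuousOn
    (continuous_E (B := B)).continuousOn
  exact ⟨max L 1, by positivity, fun σ hσ => (hL σ (abs_le.1 hσ)).trans (le_max_left _ _)⟩

/-- The potential of H is at least c₂|H| in the upper box, at most S everywhere in view, and, for K
large, approximately at most half of c₂|H| on the lateral side. Comparison at level ℓ/2 uses the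
difference. -/
theorem IsDriftMatrix.exists_weakEstimate (hB : IsDriftMatrix B) {lam Lam : ℝ} (hlam : 0 < lam)
    (hLam : 0 < Lam) (hQ : 0 < homDim p) (hCordes : Lam / lam < 1 + 2 / (homDim p : ℝ))
    {b R : ℝ} (hb : 0 < b) (hb1 : b ≤ 1) (hR : 0 < R) :
    ∃ K > R, ∃ c > 0, WeakEstimate B lam Lam b R K c := by
  have hQ' : (0 : ℝ) < homDim p := by exact_mod_cast hQ
  set s : ℝ := Lam * homDim p / (2 * lam) with hs
  have hs0 : 0 < s := by positivity
  have hs1 : s < homDim p / 2 + 1 := by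
    have h1 : s = Lam / lam * (homDim p / 2) := by rw [hs]; field_simp
    have h2 : (1 + 2 / (homDim p : ℝ)) * (homDim p / 2) = homDim p / 2 + 1 := by field_simp
    rw [h1, ← h2]
    gcongr
  obtain ⟨c₂, hc₂, hlow⟩ := exists_kernel_lower (B := B) lam s
    (K := (fun q : SpaceTime p × SpaceTime p => chartInv B q.2 1 q.1) ''
      (upperBox p R b ×ˢ lowerBox p R b))
    (((isCompact_upperBox R b).prod (isCompact_lowerBox R b)).image continuous_chartInv_uncurry) (by
      rintro _ ⟨⟨z, ζ⟩, ⟨hz, hζ⟩, rfl⟩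
      have h1 := hz.2.1
      have h2 := hζ.2.2
      simp only [chartInv, one_pow, inv_one, one_mul] at h1 h2 ⊢
      linarith)
  obtain ⟨R', hR', hsmall⟩ := hB.exists_kernel_small hlam hs0 (half_pos hc₂)
  obtain ⟨L, hL, hEL⟩ := exists_norm_E_le B
  obtain ⟨S, hS, hpot⟩ := hB.exists_potential_le hlam hs1
  set V := (volume (lowerBox p R b)).toReal with hV
  have hV0 : 0 ≤ V := ENNReal.toReal_nonneg
  -- K keeps lateral points at distance R' from every transported pole E(σ)ξ. The first bound on c
  -- comes from the comparison, the second settles points where u > ℓ/2.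
  refine ⟨R' + L * R + R, by nlinarith [mul_pos hL hR], min (c₂ / (4 * (S + 1))) (1 / (2 * (V + 1))),
    by positivity, ?_⟩
  intro Ω A u hΩ hA hu hsub hu0 hLu H hHsub hH ℓ hℓ hHu
  set K := R' + L * R + R with hK
  set VH := (volume H).toReal with hVH
  have hVH0 : 0 ≤ VH := ENNReal.toReal_nonneg
  have hVHV : VH ≤ V :=
    ENNReal.toReal_mono (isCompact_lowerBox R b).measure_lt_top.ne (measure_mono hHsub)
  set c := min (c₂ / (4 * (S + 1))) (1 / (2 * (V + 1))) with hc
  have hcV : c * VH ≤ 1 / 2 := by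
    calc c * VH ≤ 1 / (2 * (V + 1)) * (V + 1) := by
          gcongr
          · exact min_le_right _ _
          · linarith
      _ = 1 / 2 := by field_simp
  have hRK : R ≤ K := by nlinarith [mul_pos hL hR]
  have hupsub : upperBox p R b ⊆ box p K b :=
    Set.prod_mono (Metric.closedBall_subset_closedBall hRK) (Set.Icc_subset_Icc_left (by linarith))
  have hlowsub : lowerBox p R b ⊆ box p K b :=
    Set.prod_mono (Metric.closedBall_subset_closedBall hRK)
      (Set.Icc_subset_Icc (by linarith) (by linarith))
  have main : ∀ z ∈ upperBox p R b, z.2 < 0 → c * ℓ * VH ≤ u z := by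
    intro z hz hz0
    rcases le_or_gt (u z) (ℓ / 2) with huz | huz
    swap
    · nlinarith
    set Z' : Set (SpaceTime p) :=
      {y ∈ Metric.closedBall (0 : Space p) K ×ˢ Set.Icc (-b) z.2 | u y ≤ ℓ / 2} with hZ'
    have hZsub : Metric.closedBall (0 : Space p) K ×ˢ Set.Icc (-b) z.2 ⊆ box p K b :=
      Set.prod_mono_right (Set.Icc_subset_Icc_right hz0.le)
    have hZ'c : IsCompact Z' := by
      have hZc : IsCompact (Metric.closedBall (0 : Space p) K ×ˢ Set.Icc (-b) z.2) :=
        (isCompact_closedBall _ _).prod isCompact_Icc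
      have h1 : IsClosed Z' := (hu.continuousOn.mono (hZsub.trans hsub)).preimage_isClosed_of_isClosed
        hZc.isClosed isClosed_Iic
      exact hZc.of_isClosed_subset h1 fun z hz => hz.1
    -- On `Z'` one has u ≤ ℓ/2 while u ≥ ℓ on H, so the kernel is continuous on the product. This
    -- choice of ε makes the total error at most 1, whence the bound S + 1.
    obtain ⟨N, ζ, m, hζH, hm0, hmV, hmF⟩ := exists_finite_sum_le_lintegral (μ := volume) hZ'c hH
      hH.measurableSet hH.measure_lt_top.ne
      (f := fun q => kernel B lam s (chartInv B q.2 1 q.1)) (by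
        rintro ⟨y, ζ⟩ ⟨hy, hζ⟩
        have hne : y ≠ ζ := by
          rintro rfl
          have := hHu _ hζ
          have := hy.2
          linarith
        exact (hB.continuousAt_kernel_chartInv hlam hs0 (q := (y, ζ)) hne).continuousWithinAt)
      (fun q => kernel_nonneg _ _ _) (ε := 1 / (VH + 1)) (by positivity)
    have hbd : ∀ y ∈ Z', ∑ i, m i * kernel B lam s (chartInv B (ζ i) 1 y) ≤ S + 1 := by
      intro y hy
      have h1 := hmF y hy
      have h2 : ∫⁻ ζ in H, ENNReal.ofReal (kernel B lam s (chartInv B ζ 1 y)) ≤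
          ENNReal.ofReal S := by
        have h3 : H ⊆ Set.univ ×ˢ Set.Ici (y.2 - 1) := fun ζ hζ => ⟨trivial, by
          have h4 := (hHsub hζ).2.1
          have h5 := hy.1.2.2
          simp only [Set.mem_Ici]
          linarith⟩
        exact (lintegral_mono_set h3).trans (hpot y)
      have h3 : ENNReal.ofReal (1 / (VH + 1)) * volume H ≤ ENNReal.ofReal 1 := by
        rw [← ENNReal.ofReal_toReal hH.measure_lt_top.ne, ← ENNReal.ofReal_mul (by positivity)]
        refine ENNReal.ofReal_le_ofReal ?_
        rw [one_div_mul_eq_div, div_le_one (by positivity)]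
        linarith
      have h4 := h1.trans (add_le_add h2 h3)
      rw [← ENNReal.ofReal_add hS.le zero_le_one] at h4
      exact (ENNReal.ofReal_le_ofReal_iff (by positivity)).1 h4
    have hcomp := hB.comparison hlam hs hs0 hΩ hA hu hz0 hsub hu0 hLu hm0 (half_pos hℓ)
      (by linarith : 0 < S + 1) (β := c₂ / 2 * VH) (by positivity)
      (fun i => (by linarith [hHu _ (hζH i)] : ℓ / 2 < u (ζ i)))
      (fun i => by linarith [(hHsub (hζH i)).2.1]) (fun y hy hyu => hbd y ⟨hy, hyu⟩) (by
        intro y hy hyK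
        rw [hVH, ← hmV, mul_sum]
        refine sum_le_sum fun i _ => ?_
        rw [mul_comm]
        refine mul_le_mul_of_nonneg_right ?_ (hm0 i)
        rcases le_or_gt y.2 (ζ i).2 with hle | hgt
        · rw [kernel_chartInv_of_le _ _ hle]; positivity
        have hζi := hHsub (hζH i)
        have h1 : (chartInv B (ζ i) 1 y).2 = y.2 - (ζ i).2 := by simp [chartInv]
        have h2 : (chartInv B (ζ i) 1 y).1 = y.1 - E B (y.2 - (ζ i).2) (ζ i).1 := by
          simp [chartInv, dil_one]
        have h3 : y.2 - (ζ i).2 ≤ 1 := by linarith [hy.2.2, hζi.2.1]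
        refine hsmall _ ?_ (h1 ▸ h3)
        rw [h2]
        have h4 : ‖E B (y.2 - (ζ i).2) (ζ i).1‖ ≤ L * R := by
          refine (ContinuousLinearMap.le_opNorm _ _).trans ?_
          gcongr
          · exact hEL _ (abs_le.2 ⟨by linarith, h3⟩)
          · exact mem_closedBall_zero_iff.1 hζi.1
        have h5 := norm_sub_norm_le y.1 (E B (y.2 - (ζ i).2) (ζ i).1)
        linarith) z ⟨(hupsub hz).1, (hupsub hz).2.1, le_rfl⟩ huz
    have hF : c₂ * VH ≤ ∑ i, m i * kernel B lam s (chartInv B (ζ i) 1 z) := by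
      rw [hVH, ← hmV, mul_sum]
      refine sum_le_sum fun i _ => ?_
      rw [mul_comm]
      exact mul_le_mul_of_nonneg_left (hlow _ ⟨(z, ζ i), ⟨hz, hHsub (hζH i)⟩, rfl⟩) (hm0 i)
    have h1 : c ≤ c₂ / (4 * (S + 1)) := min_le_left _ _
    rw [le_div_iff₀ (by positivity)] at h1
    have h2 : ℓ / 2 * (c₂ / 2 * VH) ≤ (S + 1) * u z := by
      refine le_trans ?_ hcomp
      gcongr
      linarith
    have h3 : (S + 1) * (c * ℓ * VH) ≤ (S + 1) * u z := by
      nlinarith [mul_le_mul_of_nonneg_right h1 (mul_nonneg hℓ.le hVH0)]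
    exact le_of_mul_le_mul_left h3 (by linarith)
  intro z hz
  -- The equation is given only for t < 0; the top t = 0 follows by continuity of u.
  rcases hz.2.2.lt_or_eq with hz0 | hz0
  · exact main z hz hz0
  have hzΩ : z ∈ Ω := hsub (hupsub hz)
  have hcont : Tendsto (fun t : ℝ => u (z.1, t)) (𝓝[<] 0) (𝓝 (u z)) := by
    have h1 : ContinuousAt u z := (hu.contDiffAt (hΩ.mem_nhds hzΩ)).continuousAt
    have h2 : Tendsto (fun t : ℝ => (z.1, t)) (𝓝[<] 0) (𝓝 z) := by
      have h3 : Tendsto (fun t : ℝ => (z.1, t)) (𝓝 0) (𝓝 (z.1, 0)) :=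
        (by fun_prop : Continuous fun t : ℝ => (z.1, t)).tendsto 0
      rw [show z = (z.1, 0) from Prod.ext rfl hz0]
      exact h3.mono_left nhdsWithin_le_nhds
    exact h1.tendsto.comp h2
  refine ge_of_tendsto hcont ?_
  have hev : ∀ᶠ t : ℝ in 𝓝[<] 0, -(b / 4) < t :=
    nhdsWithin_le_nhds (lt_mem_nhds (by linarith))
  filter_upwards [hev, self_mem_nhdsWithin] with t ht ht0
  exact main (z.1, t) ⟨hz.1, ht.le, le_of_lt ht0⟩ ht0

/-! ### Growth of large values and the Harnack inequality at the origin -/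

theorem operatorL_const_sub (a : ℝ) (hu : ContDiffAt ℝ 2 u z) :
    operatorL B A (fun y => a - u y) z = -operatorL B A u z := by
  have h1 : (fun y => a - u y) = (fun _ => a) + fun y => -1 * u y := by
    funext y; simp [sub_eq_add_neg]
  rw [h1, operatorL_add contDiffAt_const (contDiffAt_const.mul hu), operatorL_const,
    operatorL_const_mul _ hu]
  ring

/-- If a solution exceeds `M` at `z₀` and the set `{u ≥ M / 2}` is small, then the solution exceeds
`(1 + η) M` in the past of `z₀`. -/
theorem IsDriftMatrix.exists_growth (hB : IsDriftMatrix B) {lam Lam b R K c : ℝ}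
    (hWE : WeakEstimate B lam Lam b R K c) (hb : 0 < b) (hR : 0 < R) (hc : 0 < c)
    {Ω : Set (SpaceTime p)} (hΩ : IsOpen Ω) (hA : ∀ z ∈ Ω, IsElliptic lam Lam (A z))
    (hu : ContDiffOn ℝ 2 u Ω) {z₀ : SpaceTime p} {r : ℝ} (hr : 0 < r)
    (hsubΩ : lowerBox p R b ⊆ Ω) (hsub : ∀ ζ ∈ box p K b, chart B z₀ r ζ ∈ lowerBox p R b)
    (hRK : R ≤ K) (hLu : ∀ z ∈ lowerBox p R b, operatorL B A u z = 0) {M η : ℝ} (hM : 0 < M)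
    (hη : 0 ≤ η) (hηc : 8 * η ≤ c * (volume (lowerBox p R b)).toReal)
    (hmeas : (volume {z ∈ lowerBox p R b | M / 2 ≤ u z}).toReal ≤
      r ^ (homDim p + 2) * (volume (lowerBox p R b)).toReal / 2)
    (hz₀ : M < u z₀) : ∃ z ∈ chart B z₀ r '' box p K b, (1 + η) * M < u z := by
  by_contra! hle
  set d := (volume (lowerBox p R b)).toReal with hd
  set Q := homDim p + 2 with hQ
  have hlb : lowerBox p R b ⊆ box p K b :=
    Set.prod_mono (Metric.closedBall_subset_closedBall hRK)
      (Set.Icc_subset_Icc (by linarith) (by linarith))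
  have huc : ContinuousOn u (lowerBox p R b) := hu.continuousOn.mono hsubΩ
  have hcc : ContinuousOn (fun ζ => u (chart B z₀ r ζ)) (lowerBox p R b) :=
    huc.comp (continuous_chart z₀ r).continuousOn fun ζ hζ => hsub ζ (hlb hζ)
  set G : Set (SpaceTime p) := {z ∈ lowerBox p R b | M / 2 ≤ u z} with hG
  set H : Set (SpaceTime p) := {ζ ∈ lowerBox p R b | u (chart B z₀ r ζ) ≤ M / 2} with hH
  have hGc : IsCompact G := (isCompact_lowerBox R b).of_isClosed_subset
    (huc.preimage_isClosed_of_isClosed (isCompact_lowerBox R b).isClosed isClosed_Ici) fun z hz => hz.1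
  have hHc : IsCompact H := (isCompact_lowerBox R b).of_isClosed_subset
    (hcc.preimage_isClosed_of_isClosed (isCompact_lowerBox R b).isClosed isClosed_Iic) fun z hz => hz.1
  have hcover : lowerBox p R b ⊆ H ∪ chart B z₀ r ⁻¹' G := fun ζ hζ => by
    rcases le_total (u (chart B z₀ r ζ)) (M / 2) with h | h
    · exact Or.inl ⟨hζ, h⟩
    · exact Or.inr ⟨hsub ζ (hlb hζ), h⟩
  -- The part of the box where u exceeds M/2 is pulled back with factor r^{-(homDim p + 2)}, so it
  -- fills at most half of the box.
  have hvol : d / 2 ≤ (volume H).toReal := by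
    have h1 := (measure_mono (μ := volume) hcover).trans (measure_union_le _ _)
    rw [volume_preimage_chart z₀ hr hGc.measurableSet] at h1
    have hfin : ENNReal.ofReal (r ^ Q)⁻¹ * volume G ≠ ⊤ :=
      ENNReal.mul_ne_top ENNReal.ofReal_ne_top hGc.measure_lt_top.ne
    have h2 := ENNReal.toReal_mono (ENNReal.add_ne_top.2 ⟨hHc.measure_lt_top.ne, hfin⟩) h1
    rw [ENNReal.toReal_add hHc.measure_lt_top.ne hfin, ENNReal.toReal_mul,
      ENNReal.toReal_ofReal (by positivity)] at h2
    have h3 : (r ^ Q)⁻¹ * (volume G).toReal ≤ d / 2 := by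
      rw [inv_mul_le_iff₀ (by positivity)]
      linarith
    linarith
  set v : SpaceTime p → ℝ := fun z => (1 + η) * M - u z with hv
  have hvd : ContDiffOn ℝ 2 v Ω := contDiffOn_const.sub hu
  set Ω' := chart B z₀ r ⁻¹' Ω with hΩ'
  have hΩ'o : IsOpen Ω' := hΩ.preimage (continuous_chart z₀ r)
  have hmem : (0 : SpaceTime p) ∈ upperBox p R b :=
    ⟨Metric.mem_closedBall_self hR.le, by simp only [Prod.snd_zero]; linarith, le_rfl⟩
  have hd' : ContDiffOn ℝ 2 (v ∘ chart B z₀ r) Ω' :=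
    hvd.comp (contDiff_chart z₀ r).contDiffOn fun ζ hζ => hζ
  have hsub' : box p K b ⊆ Ω' := fun ζ hζ => hsubΩ (hsub ζ hζ)
  have hv0 : ∀ ζ ∈ box p K b, 0 ≤ (v ∘ chart B z₀ r) ζ := fun ζ hζ =>
    sub_nonneg.2 (hle _ ⟨ζ, hζ, rfl⟩)
  have hLv : ∀ ζ ∈ Metric.ball (0 : Space p) K ×ˢ Set.Ioo (-b) 0,
      operatorL B (A ∘ chart B z₀ r) (v ∘ chart B z₀ r) ζ ≤ 0 := by
    intro ζ hζ
    have h1 : chart B z₀ r ζ ∈ lowerBox p R b :=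
      hsub ζ ⟨Metric.ball_subset_closedBall hζ.1, Set.Ioo_subset_Icc_self hζ.2⟩
    have h2 : ContDiffAt ℝ 2 u (chart B z₀ r ζ) := hu.contDiffAt (hΩ.mem_nhds (hsubΩ h1))
    have h3 : ContDiffAt ℝ 2 v (chart B z₀ r ζ) := contDiffAt_const.sub h2
    have h4 : operatorL B A v (chart B z₀ r ζ) = 0 := by
      rw [hv, operatorL_const_sub _ h2, hLu _ h1, neg_zero]
    have h5 := hB.operatorL_comp_chart (A' := A ∘ chart B z₀ r) rfl
      (hA _ (hsubΩ h1)).block_eq_zero h3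
    rw [h5, h4, mul_zero]
  have hvH : ∀ ζ ∈ H, M / 2 ≤ (v ∘ chart B z₀ r) ζ := by
    intro ζ hζ
    have h1 : u (chart B z₀ r ζ) ≤ M / 2 := hζ.2
    have h2 : 0 ≤ η * M := by positivity
    simp only [Function.comp, hv]
    linarith
  have h := hWE Ω' (A ∘ chart B z₀ r) (v ∘ chart B z₀ r) hΩ'o (fun ζ hζ => hA _ hζ) hd' hsub' hv0
    hLv H (fun ζ hζ => hζ.1) hHc (M / 2) (half_pos hM) hvH 0 hmem
  have h0 : chart B z₀ r 0 = z₀ := by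
    rw [chart_apply]; ext1 <;> simp [E_zero]
  simp only [Function.comp, h0, hv] at h
  -- The estimate at the centre gives cMd/4 ≤ (1+η)M - u(z₀) < ηM, while 8η ≤ cd: a contradiction.
  have h1 : c * (M / 2) * (d / 2) ≤ c * (M / 2) * (volume H).toReal := by gcongr
  nlinarith [mul_le_mul_of_nonneg_right hηc hM.le, mul_nonneg hη hM.le]

/-- Bounds the displacement of the centre of a chart by the elapsed time, so that the steps of the
iteration can be summed. -/
theorem exists_norm_E_sub_le (B : Matrix (Coord p) (Coord p) ℝ) :
    ∃ L > 0, ∀ σ : ℝ, |σ| ≤ 1 → ∀ x : Space p, ‖E B σ x - x‖ ≤ L * |σ| * ‖x‖ := by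
  obtain ⟨L, hL, hE⟩ := exists_norm_E_le B
  refine ⟨‖driftCLM B‖ * L + 1, by positivity, fun σ hσ x => ?_⟩
  have h1 : ∀ τ ∈ Set.Icc (-1 : ℝ) 1,
      HasDerivWithinAt (fun τ => E B τ x) (-driftCLM B (E B τ x)) (Set.Icc (-1) 1) τ := by
    intro τ _
    have := (hasDerivAt_E (B := B) τ).clm_apply (hasDerivAt_const τ x)
    rw [map_zero, add_zero] at this
    exact this.hasDerivWithinAt
  have h2 : ∀ τ ∈ Set.Icc (-1 : ℝ) 1,
      ‖-driftCLM B (E B τ x)‖ ≤ (‖driftCLM B‖ * L + 1) * ‖x‖ := by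
    intro τ hτ
    rw [norm_neg]
    calc ‖driftCLM B (E B τ x)‖ ≤ ‖driftCLM B‖ * (L * ‖x‖) := by
          refine ((driftCLM B).le_opNorm _).trans ?_
          gcongr
          refine ((E B τ).le_opNorm _).trans ?_
          gcongr
          exact hE τ (abs_le.2 hτ)
      _ ≤ _ := by nlinarith [norm_nonneg x]
  have h3 := Convex.norm_image_sub_le_of_norm_hasDerivWithin_le h1 h2 (convex_Icc _ _)
    (show (0 : ℝ) ∈ Set.Icc (-1 : ℝ) 1 by constructor <;> norm_num)
    (show σ ∈ Set.Icc (-1 : ℝ) 1 from abs_le.1 hσ)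
  rw [E_zero, sub_zero, Real.norm_eq_abs] at h3
  calc ‖E B σ x - x‖ ≤ (‖driftCLM B‖ * L + 1) * ‖x‖ * |σ| := h3
    _ = _ := by ring

theorem volume_lowerBox_pos {R b : ℝ} (hR : 0 < R) (hb : 0 < b) :
    0 < (volume (lowerBox p R b)).toReal := by
  refine ENNReal.toReal_pos ?_ (isCompact_lowerBox R b).measure_lt_top.ne
  rw [lowerBox, Measure.volume_eq_prod, Measure.prod_prod]
  refine mul_ne_zero (Metric.measure_closedBall_pos _ _ hR).ne' ?_
  rw [Real.volume_Icc]
  simp only [ne_eq, ENNReal.ofReal_eq_zero, not_le]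
  linarith

set_option maxHeartbeats 1000000 in
/-- The Harnack inequality in cylinders centred at the origin. -/
theorem IsDriftMatrix.exists_harnack (hB : IsDriftMatrix B) {lam Lam : ℝ} (hlam : 0 < lam)
    (hLam : 0 < Lam) (hQ : 0 < homDim p) (hCordes : Lam / lam < 1 + 2 / (homDim p : ℝ))
    {b R₀ : ℝ} (hb : 0 < b) (hb1 : b ≤ 1) (hR₀ : 0 < R₀) :
    ∃ K > 0, ∃ C > 0, ∀ (Ω : Set (SpaceTime p)) (A : SpaceTime p → Matrix (Coord p) (Coord p) ℝ)
      (u : SpaceTime p → ℝ), IsOpen Ω → (∀ z ∈ Ω, IsElliptic lam Lam (A z)) →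
      ContDiffOn ℝ 2 u Ω → box p K b ⊆ Ω → (∀ z ∈ box p K b, 0 ≤ u z) →
      (∀ z ∈ Metric.ball (0 : Space p) K ×ˢ Set.Ioo (-b) 0, operatorL B A u z = 0) →
      ∀ z ∈ Metric.closedBall (0 : Space p) R₀ ×ˢ Set.Icc (-(3 * b / 4)) (-(b / 2)),
      ∀ w ∈ upperBox p R₀ b, u z ≤ C * u w := by
  set R := R₀ + 1 with hR
  have hR1 : 0 < R := by positivity
  obtain ⟨K, hRK, c, hc, hWE⟩ := hB.exists_weakEstimate hlam hLam hQ hCordes hb hb1 hR1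
  obtain ⟨L, hL, hEL⟩ := exists_norm_E_sub_le B
  have hK0 : 0 < K := hR1.trans hRK
  set d := (volume (lowerBox p R b)).toReal with hd
  have hd0 : 0 < d := volume_lowerBox_pos hR1 hb
  set η := c * d / 8 with hη
  have hη0 : 0 < η := by positivity
  set Q := homDim p + 2 with hQ2
  -- The radii may shrink by θ per step: the loss θ^Q in volume is compensated by the growth factor
  -- 1 + η of u, where Q = `homDim p + 2`.
  obtain ⟨θ, hθ0, hθ1, hθη⟩ : ∃ θ : ℝ, 0 < θ ∧ θ < 1 ∧ 1 ≤ θ ^ Q * (1 + η) := by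
    have h1 : Tendsto (fun θ : ℝ => θ ^ Q * (1 + η)) (𝓝[<] 1) (𝓝 (1 ^ Q * (1 + η))) :=
      ((by fun_prop : Continuous fun θ : ℝ => θ ^ Q * (1 + η)).tendsto 1).mono_left
        nhdsWithin_le_nhds
    rw [one_pow, one_mul] at h1
    have h2 := h1.eventually (lt_mem_nhds (by linarith : (1 : ℝ) < 1 + η))
    have h3 : ∀ᶠ θ : ℝ in 𝓝[<] 1, 0 < θ := nhdsWithin_le_nhds (lt_mem_nhds one_pos)
    obtain ⟨θ, h4, h5, h6⟩ := (h2.and (h3.and self_mem_nhdsWithin)).exists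
    exact ⟨θ, h5, h6, h4.le⟩
  set κ := K + L * R with hκ
  have hκ0 : 0 < κ := by positivity
  -- The total displacement is at most κρ/(1-θ) in space and bρ/(1-θ) in time. This ρ keeps both
  -- within the margins of the lower box: 1 in radius and b/8 in time.
  set ρ := (1 - θ) / (8 * (κ + 1)) with hρ
  have h1θ : 0 < 1 - θ := by linarith
  have hρ0 : 0 < ρ := by positivity
  have hρκ : ρ * (κ + 1) = (1 - θ) / 8 := by rw [hρ]; field_simp
  have hρ1 : ρ ≤ (1 - θ) / 8 := by nlinarith
  set s : ℕ → ℝ := fun k => ∑ j ∈ range k, θ ^ j with hs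
  have hs0 : ∀ k, 0 ≤ s k := fun k => sum_nonneg fun j _ => by positivity
  have hs1 : ∀ k, s k * (1 - θ) ≤ 1 := fun k => by
    have := geom_sum_mul_neg θ k
    rw [hs]
    simp only
    rw [this]
    linarith [pow_pos hθ0 k]
  have hsρ : ∀ k, ρ * s k * (κ + 1) ≤ 1 / 8 := fun k => by
    calc ρ * s k * (κ + 1) = (s k * (1 - θ)) / 8 := by rw [mul_right_comm, hρκ]; ring
      _ ≤ 1 / 8 := by linarith [hs1 k]
  set D : ℕ → Set (SpaceTime p) := fun k => Metric.closedBall (0 : Space p) (R₀ + κ * ρ * s k) ×ˢ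
    Set.Icc (-(3 * b / 4) - b * ρ * s k) (-(b / 2)) with hD
  have hDsub : ∀ k, D k ⊆ lowerBox p R b := fun k => by
    have h1 := hsρ k
    have h2 := mul_nonneg hρ0.le (hs0 k)
    refine Set.prod_mono (Metric.closedBall_subset_closedBall ?_) (Set.Icc_subset_Icc_left ?_)
    · nlinarith
    · nlinarith [mul_nonneg hκ0.le h2]
  -- Chosen so that the weak estimate, with level M/2 and M = Cm(1+η)ᵏ, gives the measure bound of
  -- the growth step at radius ρθᵏ for every k.
  set C := 4 / (c * d * ρ ^ Q) with hC
  have hC0 : 0 < C := by positivity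
  refine ⟨K, hK0, C, hC0, ?_⟩
  intro Ω A u hΩ hA hu hsub hu0 hLu z hz w hw
  have hlb : lowerBox p R b ⊆ Metric.ball (0 : Space p) K ×ˢ Set.Ioo (-b) 0 :=
    Set.prod_mono (Metric.closedBall_subset_ball hRK)
      (Set.Icc_subset_Ioo (by linarith) (by linarith))
  have hlb' : lowerBox p R b ⊆ box p K b :=
    hlb.trans (Set.prod_mono Metric.ball_subset_closedBall Set.Ioo_subset_Icc_self)
  have huc : ContinuousOn u (lowerBox p R b) := hu.continuousOn.mono (hlb'.trans hsub)
  have hwR : w ∈ upperBox p R b :=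
    ⟨Metric.closedBall_subset_closedBall (by linarith) hw.1, hw.2⟩
  -- A positive m replaces u(w), which may vanish; the excess ε/C is removed at the end.
  suffices H : ∀ m > 0, u w ≤ m → u z ≤ C * m by
    refine le_of_forall_pos_le_add fun ε hε => ?_
    have hub : w ∈ box p K b := ⟨Metric.closedBall_subset_closedBall hRK.le hwR.1,
      Set.Icc_subset_Icc_left (by linarith) hw.2⟩
    have h1 := H (u w + ε / C) (by have := hu0 w hub; positivity) (by
      have : 0 < ε / C := by positivity
      linarith)
    rwa [mul_add, mul_div_cancel₀ _ hC0.ne'] at h1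
  intro m hm hwm
  by_contra! hlt
  have key : ∀ k : ℕ, ∃ y ∈ D k, C * m * (1 + η) ^ k < u y := by
    intro k
    induction k with
    | zero => exact ⟨z, by simpa [hD, hs] using hz, by simpa using hlt⟩
    | succ k ih =>
      obtain ⟨y, hy, hyM⟩ := ih
      set r := ρ * θ ^ k with hr
      have hr0 : 0 < r := by positivity
      have hθk : θ ^ k ≤ 1 := pow_le_one₀ hθ0.le hθ1.le
      have hr1 : r ≤ 1 := by nlinarith [pow_pos hθ0 k]
      set M := C * m * (1 + η) ^ k with hM
      have hM0 : 0 < M := by positivity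
      have hyR : ‖y.1‖ ≤ R := mem_closedBall_zero_iff.1 (hDsub k hy).1
      have hchart : ∀ ζ ∈ box p K b, chart B y r ζ ∈ D (k + 1) := by
        intro ζ hζ
        have hsk : s (k + 1) = s k + θ ^ k := sum_range_succ _ _
        have hζ1 := mem_closedBall_zero_iff.1 hζ.1
        -- The time shift is of order r², but the weaker linear bound suffices and sums
        -- geometrically together with the spatial shift.
        have hζ2 : |r ^ 2 * ζ.2| ≤ r * b := by
          rw [abs_of_nonpos (mul_nonpos_of_nonneg_of_nonpos (by positivity) hζ.2.2)]
          calc -(r ^ 2 * ζ.2) = r * (r * -ζ.2) := by ring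
            _ ≤ r * (1 * b) := by
              gcongr
              · linarith [hζ.2.2]
              · linarith [hζ.2.1]
            _ = r * b := by ring
        have hrb : r * b ≤ r := by nlinarith
        refine ⟨mem_closedBall_zero_iff.2 ?_, ?_, ?_⟩
        · have h1 : (chart B y r ζ).1 = dil r ζ.1 + y.1 + (E B (r ^ 2 * ζ.2) y.1 - y.1) := by
            rw [chart_apply]; simp only; abel
          have h2 := hEL (r ^ 2 * ζ.2) (by linarith) y.1
          have h3 : L * |r ^ 2 * ζ.2| * ‖y.1‖ ≤ L * r * R := by
            gcongr
            linarith
          have h4 := norm_dil_le hr0.le hr1 ζ.1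
          have h5 : r * ‖ζ.1‖ ≤ r * K := by gcongr
          have h6 := mem_closedBall_zero_iff.1 hy.1
          rw [h1, hsk]
          have h7 := norm_add₃_le (a := dil r ζ.1) (b := y.1)
            (c := E B (r ^ 2 * ζ.2) y.1 - y.1)
          have h8 : κ * ρ * θ ^ k = r * K + L * r * R := by rw [hκ, hr]; ring
          rw [mul_add, h8]
          linarith
        · have h1 := hy.2.1
          have h2 := (abs_le.1 hζ2).1
          rw [chart_apply, hsk]
          simp only
          have h3 : b * ρ * θ ^ k = r * b := by rw [hr]; ring
          rw [mul_add, h3]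
          linarith
        · have h1 := hy.2.2
          have h2 : r ^ 2 * ζ.2 ≤ 0 := mul_nonpos_of_nonneg_of_nonpos (by positivity) hζ.2.2
          rw [chart_apply]
          simp only
          linarith
      have hmeas : (volume {z ∈ lowerBox p R b | M / 2 ≤ u z}).toReal ≤ r ^ Q * d / 2 := by
        have hGc : IsCompact {z ∈ lowerBox p R b | M / 2 ≤ u z} :=
          (isCompact_lowerBox R b).of_isClosed_subset
            (huc.preimage_isClosed_of_isClosed (isCompact_lowerBox R b).isClosed isClosed_Ici)
            fun z hz => hz.1
        have h1 := hWE Ω A u hΩ hA hu hsub hu0 (fun z hz => (hLu z hz).le) _ (fun z hz => hz.1) hGc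
          (M / 2) (by positivity) (fun z hz => hz.2) w hwR
        set G := (volume {z ∈ lowerBox p R b | M / 2 ≤ u z}).toReal with hG
        have h2 : 1 ≤ (θ ^ k) ^ Q * (1 + η) ^ k := by
          rw [← pow_mul, mul_comm k Q, pow_mul, ← mul_pow]
          exact one_le_pow₀ hθη
        have h3 : C * (c * d * ρ ^ Q) = 4 := by rw [hC]; field_simp
        have h4 : c * (M / 2) * (r ^ Q * d / 2) = m * ((θ ^ k) ^ Q * (1 + η) ^ k) := by
          calc c * (M / 2) * (r ^ Q * d / 2) =
              (C * (c * d * ρ ^ Q)) / 4 * (m * ((θ ^ k) ^ Q * (1 + η) ^ k)) := by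
                rw [hM, hr, mul_pow]; ring
            _ = _ := by rw [h3]; ring
        have h5 : c * (M / 2) * G ≤ c * (M / 2) * (r ^ Q * d / 2) := by
          rw [h4]
          exact (h1.trans hwm).trans (le_mul_of_one_le_right hm.le h2)
        exact le_of_mul_le_mul_left h5 (by positivity)
      obtain ⟨y', ⟨ζ, hζ, rfl⟩, hy'⟩ := hB.exists_growth hWE hb hR1 hc hΩ hA hu hr0
        (hlb'.trans hsub) (fun ζ hζ => hDsub (k + 1) (hchart ζ hζ)) hRK.le
        (fun z hz => hLu z (hlb hz)) hM0 hη0.le (by rw [hη]; linarith) hmeas hyM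
      exact ⟨_, hchart ζ hζ, by rw [pow_succ]; linarith⟩
  -- u is bounded on the compact lower box, which contains all the points constructed.
  obtain ⟨S, hS⟩ := (isCompact_lowerBox R b).exists_bound_of_continuousOn huc
  have htend : Tendsto (fun k : ℕ => C * m * (1 + η) ^ k) atTop atTop :=
    (tendsto_pow_atTop_atTop_of_one_lt (by linarith)).const_mul_atTop (by positivity)
  obtain ⟨k, hk⟩ := (htend.eventually_ge_atTop S).exists
  obtain ⟨y, hy, hyk⟩ := key k
  have h1 := hS y (hDsub k hy)
  have h2 := le_abs_self (u y)
  rw [Real.norm_eq_abs] at h1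
  linarith

/-! ### The homogeneous norm and cylinders at arbitrary points -/

theorem continuous_homNorm : Continuous (homNorm : Space p → ℝ) := by
  refine continuous_finsetSum _ fun i _ => Continuous.rpow_const ?_ fun _ => Or.inr (by positivity)
  have : Continuous fun x : Space p => component x i := by
    unfold component
    fun_prop
  exact this.norm

theorem homNorm_zero : homNorm (0 : Space p) = 0 := by
  refine sum_eq_zero fun i _ => ?_
  have h : component (0 : Space p) i = 0 := by ext a; rfl
  rw [h, norm_zero, Real.zero_rpow (by positivity)]

theorem homNorm_pos {x : Space p} (hx : x ≠ 0) : 0 < homNorm x := by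
  obtain ⟨c, hc⟩ : ∃ c, x c ≠ 0 := by
    by_contra! h
    exact hx (by ext c; exact h c)
  refine sum_pos' (fun i _ => by positivity) ⟨c.1, mem_univ _, ?_⟩
  have : component x c.1 ≠ 0 := fun h => hc (congrArg (fun v => v.ofLp c.2) h)
  have : 0 < ‖component x c.1‖ := norm_pos_iff.2 this
  positivity

/-- Ordinary scaling does not act homogeneously, but monotonicity along rays is enough to compare
homogeneous balls with the Euclidean unit ball. -/
theorem homNorm_smul_le {c : ℝ} (hc0 : 0 ≤ c) (hc1 : c ≤ 1) (x : Space p) :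
    homNorm (c • x) ≤ homNorm x := by
  refine sum_le_sum fun i _ => ?_
  have h : component (c • x) i = c • component x i := rfl
  rw [h, norm_smul, Real.norm_of_nonneg hc0]
  gcongr
  exact mul_le_of_le_one_left (norm_nonneg _) hc1

theorem homNorm_dil {r : ℝ} (hr : 0 < r) (x : Space p) : homNorm (dil r x) = r * homNorm x := by
  rw [homNorm, homNorm, mul_sum]
  refine sum_congr rfl fun i _ => ?_
  have h : component (dil r x) i = r ^ (2 * (i : ℕ) + 1) • component x i := by
    ext a; exact dil_apply r x ⟨i, a⟩
  rw [h, norm_smul, Real.norm_of_nonneg (by positivity),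
    Real.mul_rpow (by positivity) (norm_nonneg _), ← Real.rpow_natCast, ← Real.rpow_mul hr.le]
  congr 1
  push_cast
  rw [mul_one_div_cancel (by positivity), Real.rpow_one]

/-- Reduces every cylinder to one at the origin with r = 1; the chart absorbs both the centre and
the radius. -/
theorem cylinder_eq (z₀ : SpaceTime p) {r : ℝ} (hr : 0 < r) (ρ a b : ℝ) :
    cylinder B (ρ * r) (a * r ^ 2) (b * r ^ 2) z₀ =
      chart B z₀ r '' (homBall p ρ ×ˢ Set.Ioo a b) := by
  ext z
  constructor
  · rintro ⟨⟨ξ, τ⟩, ⟨hξ, hτ⟩, rfl⟩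
    refine ⟨(dil r⁻¹ ξ, τ / r ^ 2), ⟨?_, ?_⟩, ?_⟩
    · have h : homNorm ξ < ρ * r := hξ
      simp only [homBall, Set.mem_ofPred_eq]
      rw [homNorm_dil (inv_pos.2 hr), inv_mul_lt_iff₀ hr, mul_comm]
      exact h
    · simp only [Set.mem_Ioo] at hτ ⊢
      exact ⟨(lt_div_iff₀ (by positivity)).2 hτ.1, (div_lt_iff₀ (by positivity)).2 hτ.2⟩
    · simp only [chart]
      rw [dil_inv_apply hr.ne', mul_div_cancel₀ _ (by positivity)]
  · rintro ⟨⟨ξ, τ⟩, ⟨hξ, hτ⟩, rfl⟩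
    refine ⟨(dil r ξ, r ^ 2 * τ), ⟨?_, ?_⟩, rfl⟩
    · have h : homNorm ξ < ρ := hξ
      simp only [homBall, Set.mem_ofPred_eq]
      rw [homNorm_dil hr, mul_comm]
      gcongr
    · simp only [Set.mem_Ioo] at hτ ⊢
      rw [mul_comm (r ^ 2)]
      constructor
      · gcongr; exact hτ.1
      · gcongr; exact hτ.2

theorem exists_norm_E_le_two (B : Matrix (Coord p) (Coord p) ℝ) :
    ∃ b > 0, ∀ s : ℝ, |s| ≤ b → ‖E B s‖ ≤ 2 := by
  have h1 : ‖E B 0‖ < 2 := by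
    rw [E_zero]
    exact lt_of_le_of_lt ContinuousLinearMap.norm_id_le one_lt_two
  obtain ⟨ε, hε, h⟩ := Metric.eventually_nhds_iff.1
    ((continuous_E (B := B)).norm.continuousAt.eventually (gt_mem_nhds h1))
  refine ⟨ε / 2, by positivity, fun s hs => (h (y := s) ?_).le⟩
  rw [Real.dist_eq, sub_zero]
  linarith

theorem nonneg_of_mem_closure {S : Set (SpaceTime p)} {y : SpaceTime p} (hu : ContinuousAt u y)
    (hS : ∀ z ∈ S, 0 ≤ u z) (hy : y ∈ closure S) : 0 ≤ u y := by
  by_contra! hneg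
  obtain ⟨z, hz, hzS⟩ := ((mem_closure_iff_frequently.1 hy).and_eventually
    (hu.eventually (gt_mem_nhds hneg))).exists
  exact hzS.not_ge (hS z hz)

/-- The Harnack inequality, with cylinders centred at an arbitrary point. -/
theorem IsDriftMatrix.exists_harnack_cylinder (hB : IsDriftMatrix B) {lam Lam : ℝ} (hlam : 0 < lam)
    (hLam : 0 < Lam) (hQ : 0 < homDim p) (hCordes : Lam / lam < 1 + 2 / (homDim p : ℝ))
    {b σ : ℝ} (hb : 0 < b) (hb1 : b ≤ 1) (hσ : ∀ x : Space p, homNorm x < σ / 2 → ‖x‖ ≤ 1) :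
    ∃ K > σ, ∃ C > 0, ∀ (Ω : Set (SpaceTime p)) (A : SpaceTime p → Matrix (Coord p) (Coord p) ℝ),
      IsOpen Ω → IsCoefficient Ω lam Lam A → ∀ (z₀ : SpaceTime p) (r : ℝ), 0 < r →
      closure (cylinder B (K * r) (-b * r ^ 2) 0 z₀) ⊆ Ω →
      ∀ u : SpaceTime p → ℝ, ContDiffOn ℝ 2 u Ω →
      (∀ z ∈ cylinder B (K * r) (-b * r ^ 2) 0 z₀, 0 ≤ u z) →
      (∀ z ∈ cylinder B (K * r) (-b * r ^ 2) 0 z₀, operatorL B A u z = 0) →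
      ∀ z ∈ cylinder B (σ / 2 * r) (-(3 * b / 4) * r ^ 2) (-(b / 2) * r ^ 2) z₀,
      ∀ w ∈ cylinder B (σ / 2 * r) (-(b / 4) * r ^ 2) 0 z₀, u z ≤ C * u w := by
  obtain ⟨K₀, hK₀, C, hC, hmain⟩ := hB.exists_harnack hlam hLam hQ hCordes hb hb1 one_pos
  obtain ⟨S, hS⟩ := (isCompact_closedBall (0 : Space p) K₀).exists_bound_of_continuousOn
    continuous_homNorm.continuousOn
  -- The homogeneous ball of radius K must contain the Euclidean ball of radius K₀, where the
  -- homogeneous norm is at most S, and K must exceed σ.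
  refine ⟨max S σ + 1, by linarith [le_max_right S σ], C, hC, ?_⟩
  set K := max S σ + 1 with hK
  intro Ω A hΩ hA z₀ r hr hcyl u hu hu0 hLu z hz w hw
  have hcylK := cylinder_eq (B := B) z₀ hr K (-b) 0
  have hcylw := cylinder_eq (B := B) z₀ hr (σ / 2) (-(b / 4)) 0
  rw [zero_mul] at hcylK hcylw
  rw [hcylK] at hcyl hu0 hLu
  rw [hcylw] at hw
  rw [cylinder_eq z₀ hr] at hz
  set Q : Set (SpaceTime p) := homBall p K ×ˢ Set.Ioo (-b) 0 with hQd
  have hball : Metric.closedBall (0 : Space p) K₀ ⊆ homBall p K := fun x hx => by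
    have h1 := hS x hx
    rw [Real.norm_eq_abs] at h1
    have h2 := le_abs_self (homNorm x)
    have h3 := le_max_left S σ
    change homNorm x < K
    linarith
  -- The closed box reaches the times -b and 0, outside the open cylinder; it lies in the closure,
  -- where u is still C² and nonnegative by continuity.
  have hbox : box p K₀ b ⊆ closure Q := by
    rw [hQd, closure_prod_eq, closure_Ioo (neg_ne_zero.2 hb.ne')]
    exact Set.prod_mono_left (hball.trans subset_closure)
  have hcl : ∀ ζ ∈ box p K₀ b, chart B z₀ r ζ ∈ closure (chart B z₀ r '' Q) := fun ζ hζ =>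
    image_closure_subset_closure_image (continuous_chart z₀ r) ⟨ζ, hbox hζ, rfl⟩
  have hell : ∀ y ∈ Ω, IsElliptic lam Lam (A y) := fun y hy => hA.isElliptic hlam hy
  have hud : ContDiffOn ℝ 2 (u ∘ chart B z₀ r) (chart B z₀ r ⁻¹' Ω) :=
    hu.comp (contDiff_chart z₀ r).contDiffOn fun ζ hζ => hζ
  have hsub : box p K₀ b ⊆ chart B z₀ r ⁻¹' Ω := fun ζ hζ => hcyl (hcl ζ hζ)
  have hcd : ∀ ζ ∈ box p K₀ b, ContDiffAt ℝ 2 u (chart B z₀ r ζ) := fun ζ hζ =>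
    hu.contDiffAt (hΩ.mem_nhds (hsub hζ))
  have hnn : ∀ ζ ∈ box p K₀ b, 0 ≤ (u ∘ chart B z₀ r) ζ := fun ζ hζ =>
    nonneg_of_mem_closure (u := u) (hcd ζ hζ).continuousAt hu0 (hcl ζ hζ)
  have hsol : ∀ ζ ∈ Metric.ball (0 : Space p) K₀ ×ˢ Set.Ioo (-b) 0,
      operatorL B (A ∘ chart B z₀ r) (u ∘ chart B z₀ r) ζ = 0 := by
    intro ζ hζ
    have h1 : ζ ∈ box p K₀ b :=
      ⟨Metric.ball_subset_closedBall hζ.1, Set.Ioo_subset_Icc_self hζ.2⟩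
    have h2 := hB.operatorL_comp_chart (A' := A ∘ chart B z₀ r) rfl
      (hell _ (hsub h1)).block_eq_zero (hcd ζ h1)
    rw [h2, hLu _ ⟨ζ, ⟨hball h1.1, hζ.2⟩, rfl⟩, mul_zero]
  obtain ⟨ζ, hζ, rfl⟩ := hz
  obtain ⟨ω, hω, rfl⟩ := hw
  exact hmain (chart B z₀ r ⁻¹' Ω) (A ∘ chart B z₀ r) (u ∘ chart B z₀ r)
    (hΩ.preimage (continuous_chart z₀ r)) (fun ζ hζ => hell _ hζ) hud hsub hnn hsol
    ζ ⟨mem_closedBall_zero_iff.2 (hσ _ hζ.1), Set.Ioo_subset_Icc_self hζ.2⟩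
    ω ⟨mem_closedBall_zero_iff.2 (hσ _ hω.1), Set.Ioo_subset_Icc_self hω.2⟩

theorem cylinder_nonempty (z₀ : SpaceTime p) {r a b : ℝ} (hr : 0 < r) (hab : a < b) :
    (cylinder B r a b z₀).Nonempty := by
  obtain ⟨t, ht⟩ := Set.nonempty_Ioo.2 hab
  refine ⟨_, (0, t), ⟨?_, ht⟩, rfl⟩
  change homNorm (0 : Space p) < r
  rwa [homNorm_zero]

end Kolmogorov

end

/-! ### The constants of the theorem -/

theorem theorem1p1 {n : ℕ} (hn : 1 ≤ n) (p : Fin (n + 1) → ℕ) (hp : Antitone p)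
    (hp_pos : ∀ i, 1 ≤ p i)
    (B : Matrix (Kolmogorov.Coord p) (Kolmogorov.Coord p) ℝ) (hB : Kolmogorov.IsDriftMatrix B)
    (lam Lam : ℝ) (hlam : 0 < lam) (hLam : 0 < Lam)
    (hCordes : Lam / lam < 1 + 2 / (Kolmogorov.homDim p : ℝ)) :
    ∃ b K σ₀ σ₁ C : ℝ, 0 < b ∧ 0 < σ₀ ∧ σ₀ < K ∧ 0 < C ∧
      IsLeast (Kolmogorov.homNorm '' Metric.sphere (0 : Kolmogorov.Space p) 1) σ₀ ∧
      IsGreatest (Kolmogorov.homNorm '' Metric.sphere (0 : Kolmogorov.Space p) 1) σ₁ ∧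
      b ≤ (σ₀ / σ₁) ^ 2 ∧ (∀ s : ℝ, |s| ≤ b → ‖Kolmogorov.E B s‖ ≤ 2) ∧
      ∀ (Ω : Set (Kolmogorov.SpaceTime p)) (A : Kolmogorov.SpaceTime p →
          Matrix (Kolmogorov.Coord p) (Kolmogorov.Coord p) ℝ),
        IsOpen Ω → Kolmogorov.IsCoefficient Ω lam Lam A →
        ∀ (z₀ : Kolmogorov.SpaceTime p) (r : ℝ), 0 < r →
          Kolmogorov.CompactlyContained
            (Kolmogorov.cylinder B (K * r) (-b * r ^ 2) 0 z₀) Ω →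
          ∀ u : Kolmogorov.SpaceTime p → ℝ, ContDiffOn ℝ 2 u Ω →
            (∀ z ∈ Kolmogorov.cylinder B (K * r) (-b * r ^ 2) 0 z₀, 0 ≤ u z) →
            (∀ z ∈ Kolmogorov.cylinder B (K * r) (-b * r ^ 2) 0 z₀,
              Kolmogorov.operatorL B A u z = 0) →
            BddAbove (u '' Kolmogorov.cylinder B (σ₀ / 2 * r)
              (-(3 * b / 4) * r ^ 2) (-(b / 2) * r ^ 2) z₀) ∧
            sSup (u '' Kolmogorov.cylinder B (σ₀ / 2 * r)
                (-(3 * b / 4) * r ^ 2) (-(b / 2) * r ^ 2) z₀) ≤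
              C * sInf (u '' Kolmogorov.cylinder B (σ₀ / 2 * r)
                (-(b / 4) * r ^ 2) 0 z₀) := by
  have : Nonempty (Kolmogorov.Coord p) := ⟨⟨0, ⟨0, hp_pos 0⟩⟩⟩
  have hQ : 0 < Kolmogorov.homDim p :=
    Finset.sum_pos (fun i _ => Nat.mul_pos (by omega) (hp_pos i)) Finset.univ_nonempty
  have hne : (Metric.sphere (0 : Kolmogorov.Space p) 1).Nonempty :=
    NormedSpace.sphere_nonempty.2 zero_le_one
  have hcont := (Kolmogorov.continuous_homNorm (p := p)).continuousOn
    (s := Metric.sphere (0 : Kolmogorov.Space p) 1)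
  obtain ⟨x₀, hx₀, hmin⟩ := (isCompact_sphere _ _).exists_isMinOn hne hcont
  obtain ⟨x₁, hx₁, hmax⟩ := (isCompact_sphere _ _).exists_isMaxOn hne hcont
  set σ₀ := Kolmogorov.homNorm x₀
  set σ₁ := Kolmogorov.homNorm x₁
  have hσ₀ : 0 < σ₀ := Kolmogorov.homNorm_pos (ne_zero_of_mem_unit_sphere ⟨x₀, hx₀⟩)
  have hσ₁ : 0 < σ₁ := Kolmogorov.homNorm_pos (ne_zero_of_mem_unit_sphere ⟨x₁, hx₁⟩)
  -- If ‖x‖ > 1, normalizing x does not increase the homogeneous norm, which would then be at least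
  -- σ₀.
  have hσ : ∀ x : Kolmogorov.Space p, Kolmogorov.homNorm x < σ₀ / 2 → ‖x‖ ≤ 1 := by
    intro x hx
    by_contra! hx1
    have h0 : 0 < ‖x‖ := by linarith
    have h1 : (‖x‖⁻¹ • x) ∈ Metric.sphere (0 : Kolmogorov.Space p) 1 := by
      simp [norm_smul, h0.ne']
    have h2 : σ₀ ≤ Kolmogorov.homNorm (‖x‖⁻¹ • x) := hmin h1
    have h3 := Kolmogorov.homNorm_smul_le (inv_nonneg.2 h0.le) (inv_le_one_of_one_le₀ hx1.le) x
    linarith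
  obtain ⟨b₀, hb₀, hE⟩ := Kolmogorov.exists_norm_E_le_two B
  -- The bound 1 limits all time lags; the other two give the operator norm bound and b ≤ (σ₀/σ₁)².
  set b := min 1 (min b₀ ((σ₀ / σ₁) ^ 2))
  have hb : 0 < b := by positivity
  obtain ⟨K, hK, C, hC, hmain⟩ := hB.exists_harnack_cylinder hlam hLam hQ hCordes hb
    (min_le_left _ _) hσ
  refine ⟨b, K, σ₀, σ₁, C, hb, hσ₀, hK, hC, ⟨⟨x₀, hx₀, rfl⟩, ?_⟩, ⟨⟨x₁, hx₁, rfl⟩, ?_⟩,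
    (min_le_right _ _).trans (min_le_right _ _),
    fun s hs => hE s (hs.trans ((min_le_right _ _).trans (min_le_left _ _))), ?_⟩
  · rintro _ ⟨x, hx, rfl⟩
    exact hmin hx
  · rintro _ ⟨x, hx, rfl⟩
    exact hmax hx
  intro Ω A hΩ hA z₀ r hr hcyl u hu hu0 hLu
  have h := hmain Ω A hΩ hA z₀ r hr hcyl.2 u hu hu0 hLu
  have hr2 : 0 < r ^ 2 := by positivity
  obtain ⟨w₀, hw₀⟩ := Kolmogorov.cylinder_nonempty (B := B) z₀ (mul_pos (half_pos hσ₀) hr)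
    (by nlinarith : -(b / 4) * r ^ 2 < 0)
  obtain ⟨y₀, hy₀⟩ := Kolmogorov.cylinder_nonempty (B := B) z₀ (mul_pos (half_pos hσ₀) hr)
    (by nlinarith : -(3 * b / 4) * r ^ 2 < -(b / 2) * r ^ 2)
  refine ⟨⟨C * u w₀, ?_⟩, csSup_le ⟨_, y₀, hy₀, rfl⟩ ?_⟩
  · rintro _ ⟨z, hz, rfl⟩
    exact h z hz w₀ hw₀
  · rintro _ ⟨z, hz, rfl⟩
    rw [← div_le_iff₀' hC]
    refine le_csInf ⟨_, w₀, hw₀, rfl⟩ ?_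
    rintro _ ⟨w, hw, rfl⟩
    rw [div_le_iff₀' hC]
    exact h z hz w hw
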